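/- Let $\mathbb K$ be a field of characteristic $0$, let $r\ge 1$, and let $V$ be a $\mathbb K$-vector space with a basis $(e_i)$ indexed by $\{-r,\dots,-1,1,\dots,r\}$. Put $\varepsilon_i=1$ for $i>0$ and $\varepsilon_i=-1$ for $i<0$. Let $\mathbf q=(q_{ij},q_i)$ be non-zero elements of $\mathbb K$ with $q_{ij}=q_{ji}^{-1}$, $q_{ii}=1$, $q_{-i}=q_i^{-1}$, $q_{-i,j}=q_{ij}^{-1}q_j^2$. With $E_i^je_l=\delta^j_le_i$, let $$P_{\mathbf q}=\sum_{i,j}q_{ij}E_j^i\otimes E_i^j,\qquad Q_{\mathbf q}=\sum_{i,j}\varepsilon_i\varepsilon_jq_iq_j^{-1}E_i^j\otimes E_{-i}^{-j},\qquad C_{\mathbf q}=\frac{1-P_{\mathbf q}}2-\frac{Q_{\mathbf q}}{2r}.$$ For an operator $T$ on $V\otimes V$ let $T^{(a,b)}$ denote $T$ acting in the sites $a,b$ of $V^{\otimes k}$. For $\omega\in\mathbb K$ let $\mathcal B_k(\omega)$ be the Brauer algebra, with generators $\sigma_a,\epsilon_a$ ($1\le a\le k-1$) and the relations $\sigma_a^2=1$,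 $\epsilon_a^2=\omega\epsilon_a$, $\sigma_a\epsilon_a=\epsilon_a\sigma_a=\epsilon_a$; $\sigma_a\sigma_b=\sigma_b\sigma_a$, $\epsilon_a\epsilon_b=\epsilon_b\epsilon_a$, $\sigma_a\epsilon_b=\epsilon_b\sigma_a$ for $|a-b|>1$; $\sigma_a\sigma_{a+1}\sigma_a=\sigma_{a+1}\sigma_a\sigma_{a+1}$, $\epsilon_a\epsilon_{a+1}\epsilon_a=\epsilon_a$, $\epsilon_{a+1}\epsilon_a\epsilon_{a+1}=\epsilon_{a+1}$, $\sigma_a\epsilon_{a+1}\epsilon_a=\sigma_{a+1}\epsilon_a$, $\epsilon_{a+1}\epsilon_a\sigma_{a+1}=\epsilon_{a+1}\sigma_a$. Let $\rho_{\mathbf q}\colon\mathcal B_k(-2r)\to\mathrm{End}(V^{\otimes k})$ be the representation $\sigma_a\mapsto-P_{\mathbf q}^{(a,a+1)}$, $\epsilon_a\mapsto-Q_{\mathbf q}^{(a,a+1)}$. For $a<b$ put $\tau=\sigma_a\sigma_{a+1}\cdots\sigma_{b-2}$, $\sigma_{ab}=\tau\sigma_{b-1}\tau^{-1}$, $\epsilon_{ab}=\tau\epsilon_{b-1}\tau^{-1}$,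 and $y_b=\sum_{a=1}^{b-1}(\sigma_{ab}-\epsilon_{ab})$. The symmetrizer is $$s_{(k)}=\frac1{k!}\prod_{b=2}^k\frac{(y_b+1)(y_b+\omega+b-3)}{2b+\omega-4}\qquad(\omega=-2r).$$ For an operator $A$ on $V\otimes V$ with entries $A^{ij}_{lm}$ let $\Xi_A$ (generators $\psi_i$) and $\Xi_A^*$ (generators $\psi^i$) be the quadratic algebras with the relations $(\Psi\otimes\Psi)(1-A)=0$ and $(1-A)(\Psi^*\otimes\Psi^*)=0$, where $\Psi=\sum_i\psi_ie^i$ and $\Psi^*=\sum_i\psi^ie_i$. For idempotent $A$, an operator $A_{(k)}\in\mathrm{End}(V^{\otimes k})$ is a pairing $A$-operator for $A$ if $$(1-A^{(a,a+1)})A_{(k)}=0=A_{(k)}(1-A^{(a,a+1)})\quad(1\le a\le k-1),$$ $$(\Psi\otimes\cdots\otimes\Psi)A_{(k)}=\Psi\otimes\cdots\otimes\Psi,\qquad A_{(k)}(\Psi^*\otimes\cdots\otimes\Psi^*)=\Psi^*\otimes\cdots\otimes\Psi^*.$$ **Theorem.** $C_{\mathbf q}$ is idempotent, and for every $k=2,\dots,r+1$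 the following hold. 1. The operator $C_{\mathbf q,(k)}=\rho_{\mathbf q}(s_{(k)})$ is a pairing $A$-operator for the idempotent $C_{\mathbf q}$. 2. There is a bilinear pairing $\langle\cdot,\cdot\rangle$ between the graded components $(\Xi^*_{C_{\mathbf q}})_k$ and $(\Xi_{C_{\mathbf q}})_k$ with $\langle\Psi^*\otimes\cdots\otimes\Psi^*,\Psi\otimes\cdots\otimes\Psi\rangle=C_{\mathbf q,(k)}$, that is, $\langle\psi^{i_1}\cdots\psi^{i_k},\psi_{j_1}\cdots\psi_{j_k}\rangle=(C_{\mathbf q,(k)})^{i_1\ldots i_k}_{j_1\ldots j_k}$, and it is non-degenerate. 3. Let $\widetilde V$ be a finite-dimensional space with a basis $(e_\alpha)$, let $\widetilde A\in\mathrm{End}(\widetilde V\otimes\widetilde V)$ be an idempotent, let $\mathfrak R$ be an associative unital $\mathbb K$-algebra, and let $M=(M^i_\alpha)$ be a $(C_{\mathbf q},\widetilde A)$-Manin matrix over $\mathfrak R$, i.e. $C_{\mathbf q}M^{(1)}M^{(2)}(1-\widetilde A)=0$. Let $f^M\colon\Xi_{\widetilde A}\to\mathfrak R\otimes\Xi_{C_{\mathbf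 q}}$ be the graded homomorphism $\widetilde\psi_\alpha\mapsto\sum_iM^i_\alpha\psi_i$, and extend the pairing of part 2 $\mathfrak R$-linearly in its second argument. Then the $A$-minors of order $k$ of $M$ are given by $$C_{\mathbf q,(k)}M^{(1)}\cdots M^{(k)}=\langle\Psi^*\otimes\cdots\otimes\Psi^*,f^M(\widetilde\Psi\otimes\cdots\otimes\widetilde\Psi)\rangle .$$ In particular this holds for multi-parametric Manin matrices of type $C$, i.e. when $\widetilde A=A_{\widehat p}=\frac{1-P_{\widehat p}}2$ for a parameter matrix $\widehat p$ (non-zero entries with $p_{\alpha\beta}=p_{\beta\alpha}^{-1}$, $p_{\alpha\alpha}=1$), where $P_{\widehat p}=\sum_{\alpha,\beta}p_{\alpha\beta}E_\beta^\alpha\otimes E_\alpha^\beta$. -/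

import Mathlib

open scoped TensorProduct

namespace ManinC

noncomputable section

/-! ### Operators on tensor powers -/

section Tensor

variable {K : Type*} [Field K] {V : Type*} [AddCommGroup V] [Module K V]
  {ι : Type*} [Fintype ι] [DecidableEq ι]

/-- The matrix unit `E_i^j` in the basis `e`: it sends `e l` to `δ^j_l e i`. -/
def unitOp (e : Module.Basis ι K V) (i j : ι) : Module.End K V :=
  (e.coord j).smulRight (e i)

/-- The entry `T^{ij}_{lm}` of an operator `T` on `V ⊗ V`:
`T (e l ⊗ e m) = ∑ i j, T^{ij}_{lm} (e i ⊗ e j)`. -/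
def entry₂ (e : Module.Basis ι K V) (T : Module.End K (V ⊗[K] V)) (i j l m : ι) : K :=
  (e.tensorProduct e).repr (T (e l ⊗ₜ[K] e m)) (i, j)

/-- The basis vector `e_{f 1} ⊗ ⋯ ⊗ e_{f k}` of the `k`-th tensor power of `V`. -/
def tvec (e : Module.Basis ι K V) {k : ℕ} (f : Fin k → ι) : ⨂[K] _ : Fin k, V :=
  PiTensorProduct.tprod K fun t => e (f t)

/-- The basis of the `k`-th tensor power of `V` that consists of the vectors `tvec e f`. -/
def tbasis (e : Module.Basis ι K V) (k : ℕ) :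
    Module.Basis (Fin k → ι) K (⨂[K] _ : Fin k, V) :=
  Basis.piTensorProduct fun _ => e

/-- The entry `T^{i_1 … i_k}_{j_1 … j_k}` of an operator `T` on the `k`-th tensor power of `V`:
`T (e_{j_1} ⊗ ⋯ ⊗ e_{j_k}) = ∑ I, T^I_J (e_{i_1} ⊗ ⋯ ⊗ e_{i_k})`. -/
def entry (e : Module.Basis ι K V) {k : ℕ} (T : Module.End K (⨂[K] _ : Fin k, V))
    (I J : Fin k → ι) : K :=
  (tbasis e k).repr (T (tvec e J)) I

/-- The operator `T^{(a,b)}` on the `k`-th tensor power: `T` acting in the sites `a ≠ b`. -/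
def siteOp (e : Module.Basis ι K V) (T : Module.End K (V ⊗[K] V)) {k : ℕ} (a b : Fin k) :
    Module.End K (⨂[K] _ : Fin k, V) :=
  ∑ i, ∑ j, ∑ l, ∑ m, entry₂ e T i j l m •
    PiTensorProduct.map
      (Function.update (Function.update (fun _ : Fin k => (1 : Module.End K V)) a (unitOp e i l))
        b (unitOp e j m))

/-- A parameter matrix: `q_{ij} = q_{ji}⁻¹`, `q_{ii} = 1`, with non-zero entries. -/
structure IsParameterMatrix (q : ι → ι → K) : Prop where
  ne_zero : ∀ i j, q i j ≠ 0
  inv : ∀ i j, q i j = (q j i)⁻¹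
  diag : ∀ i, q i i = 1

/-- The `q`-permutation operator `P_q = ∑ q_{ij} E_j^i ⊗ E_i^j`. -/
def permOp (e : Module.Basis ι K V) (q : ι → ι → K) : Module.End K (V ⊗[K] V) :=
  ∑ i, ∑ j, q i j • TensorProduct.map (unitOp e j i) (unitOp e i j)

/-- The type A idempotent `A_q = (1 - P_q) / 2`. -/
def idemA (e : Module.Basis ι K V) (q : ι → ι → K) : Module.End K (V ⊗[K] V) :=
  (2 : K)⁻¹ • (1 - permOp e q)

end Tensor

/-! ### Quadratic algebras, Manin matrices and pairing operators -/

section Quadratic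

variable {K : Type*} [Field K] {V : Type*} [AddCommGroup V] [Module K V]
  {ι : Type*} [Fintype ι] [DecidableEq ι]

/-- The relations `(Ψ ⊗ Ψ)(1 - A) = 0`, that is `∑ ψ_i ψ_j (1 - A)^{ij}_{lm} = 0`. -/
inductive XiRel (e : Module.Basis ι K V) (A : Module.End K (V ⊗[K] V)) :
    FreeAlgebra K ι → FreeAlgebra K ι → Prop
  | rel (l m : ι) : XiRel e A
      (∑ i, ∑ j, entry₂ e (1 - A) i j l m • (FreeAlgebra.ι K i * FreeAlgebra.ι K j)) 0

/-- The quadratic algebra `Ξ_A`, generated by the `ψ_i` with the relations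
`(Ψ ⊗ Ψ)(1 - A) = 0`. -/
abbrev Xi (e : Module.Basis ι K V) (A : Module.End K (V ⊗[K] V)) : Type _ :=
  RingQuot (XiRel e A)

/-- The relations `(1 - A)(Ψ* ⊗ Ψ*) = 0`, that is `∑ (1 - A)^{ij}_{lm} ψ^l ψ^m = 0`. -/
inductive XiStarRel (e : Module.Basis ι K V) (A : Module.End K (V ⊗[K] V)) :
    FreeAlgebra K ι → FreeAlgebra K ι → Prop
  | rel (i j : ι) : XiStarRel e A
      (∑ l, ∑ m, entry₂ e (1 - A) i j l m • (FreeAlgebra.ι K l * FreeAlgebra.ι K m)) 0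

/-- The quadratic algebra `Ξ*_A`, generated by the `ψ^i` with the relations
`(1 - A)(Ψ* ⊗ Ψ*) = 0`. -/
abbrev XiStar (e : Module.Basis ι K V) (A : Module.End K (V ⊗[K] V)) : Type _ :=
  RingQuot (XiStarRel e A)

variable (e : Module.Basis ι K V) (A : Module.End K (V ⊗[K] V))

/-- The generator `ψ_i` of `Ξ_A`. -/
def psi (i : ι) : Xi e A := RingQuot.mkAlgHom K (XiRel e A) (FreeAlgebra.ι K i)

/-- The generator `ψ^i` of `Ξ*_A`. -/
def psiStar (i : ι) : XiStar e A := RingQuot.mkAlgHom K (XiStarRel e A) (FreeAlgebra.ι K i)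

/-- The monomial `ψ_{j_1} ⋯ ψ_{j_k}`. -/
def psiMon {k : ℕ} (J : Fin k → ι) : Xi e A := (List.ofFn fun t => psi e A (J t)).prod

/-- The monomial `ψ^{i_1} ⋯ ψ^{i_k}`. -/
def psiStarMon {k : ℕ} (I : Fin k → ι) : XiStar e A :=
  (List.ofFn fun t => psiStar e A (I t)).prod

/-- The `k`-th graded component of `Ξ_A`. -/
def XiDeg (k : ℕ) : Submodule K (Xi e A) :=
  Submodule.span K (Set.range fun J : Fin k → ι => psiMon e A J)

/-- The `k`-th graded component of `Ξ*_A`. -/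
def XiStarDeg (k : ℕ) : Submodule K (XiStar e A) :=
  Submodule.span K (Set.range fun I : Fin k → ι => psiStarMon e A I)

/-- The monomial `ψ_{j_1} ⋯ ψ_{j_k}` as an element of the `k`-th component. -/
def psiDeg {k : ℕ} (J : Fin k → ι) : XiDeg e A k :=
  ⟨psiMon e A J, Submodule.subset_span ⟨J, rfl⟩⟩

/-- The monomial `ψ^{i_1} ⋯ ψ^{i_k}` as an element of the `k`-th component. -/
def psiStarDeg {k : ℕ} (I : Fin k → ι) : XiStarDeg e A k :=
  ⟨psiStarMon e A I, Submodule.subset_span ⟨I, rfl⟩⟩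

/-- `T` is the `k`-th pairing `A`-operator for the idempotent `A`:
* `(1 - A^{(a,a+1)}) T = T (1 - A^{(a,a+1)}) = 0` for all neighbouring sites `a`, `a + 1`;
* `(Ψ ⊗ ⋯ ⊗ Ψ) T = Ψ ⊗ ⋯ ⊗ Ψ` and `T (Ψ* ⊗ ⋯ ⊗ Ψ*) = Ψ* ⊗ ⋯ ⊗ Ψ*`, with `k` factors. -/
structure IsPairingAOp (k : ℕ) (T : Module.End K (⨂[K] _ : Fin k, V)) : Prop where
  left_mul : ∀ a b : Fin k, (b : ℕ) = a + 1 → (1 - siteOp e A a b) * T = 0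
  right_mul : ∀ a b : Fin k, (b : ℕ) = a + 1 → T * (1 - siteOp e A a b) = 0
  psi_mul : ∀ J : Fin k → ι, ∑ I : Fin k → ι, entry e T I J • psiMon e A I = psiMon e A J
  mul_psiStar : ∀ I : Fin k → ι,
    ∑ J : Fin k → ι, entry e T I J • psiStarMon e A J = psiStarMon e A I

variable {W : Type*} [AddCommGroup W] [Module K W] {κ : Type*} [Fintype κ] [DecidableEq κ]
  (e' : Module.Basis κ K W) (A' : Module.End K (W ⊗[K] W))
  {R : Type*} [Ring R] [Algebra K R]

/-- `M` is an `(A, A')`-Manin matrix over `R`: `A M^{(1)} M^{(2)} (1 - A') = 0`, entry-wise. -/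
def IsManin (M : Matrix ι κ R) : Prop :=
  ∀ (i j : ι) (γ δ : κ),
    ∑ l, ∑ m, entry₂ e A i j l m • (M l γ * M m δ) =
      ∑ l, ∑ m, ∑ α, ∑ β, (entry₂ e A i j l m * entry₂ e' A' α β γ δ) • (M l α * M m β)

/-- The entry in the row `I` and the column `α` of `T M^{(1)} ⋯ M^{(k)}`. When `T` is the `k`-th
pairing `A`-operator for `A`, these are the `A`-minors of order `k` of `M`. -/
def minorA {k : ℕ} (T : Module.End K (⨂[K] _ : Fin k, V)) (M : Matrix ι κ R)
    (I : Fin k → ι) (α : Fin k → κ) : R :=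
  ∑ J : Fin k → ι, entry e T I J • (List.ofFn fun t => M (J t) (α t)).prod

end Quadratic

/-! ### The Brauer algebra -/

section Brauer

/-- The generators `σ_a` and `ε_a`, `a = 1, …, k - 1`. -/
inductive BrauerGen (k : ℕ) : Type
  | sigma (a : ℕ) (h : 1 ≤ a ∧ a < k) : BrauerGen k
  | eps (a : ℕ) (h : 1 ≤ a ∧ a < k) : BrauerGen k

variable (K : Type*) [Field K] (k : ℕ)

/-- `σ_a` in the free algebra. -/
def freeSigma (a : ℕ) (h : 1 ≤ a ∧ a < k) : FreeAlgebra K (BrauerGen k) :=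
  FreeAlgebra.ι K (BrauerGen.sigma a h)

/-- `ε_a` in the free algebra. -/
def freeEps (a : ℕ) (h : 1 ≤ a ∧ a < k) : FreeAlgebra K (BrauerGen k) :=
  FreeAlgebra.ι K (BrauerGen.eps a h)

/-- The defining relations of the Brauer algebra with parameter `ω`. -/
inductive BrauerRel (ω : K) :
    FreeAlgebra K (BrauerGen k) → FreeAlgebra K (BrauerGen k) → Prop
  | sigma_sq (a : ℕ) (h : 1 ≤ a ∧ a < k) :
      BrauerRel ω (freeSigma K k a h * freeSigma K k a h) 1
  | eps_sq (a : ℕ) (h : 1 ≤ a ∧ a < k) :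
      BrauerRel ω (freeEps K k a h * freeEps K k a h) (ω • freeEps K k a h)
  | sigma_eps (a : ℕ) (h : 1 ≤ a ∧ a < k) :
      BrauerRel ω (freeSigma K k a h * freeEps K k a h) (freeEps K k a h)
  | eps_sigma (a : ℕ) (h : 1 ≤ a ∧ a < k) :
      BrauerRel ω (freeEps K k a h * freeSigma K k a h) (freeEps K k a h)
  | comm_sigma_sigma (a b : ℕ) (ha : 1 ≤ a ∧ a < k) (hb : 1 ≤ b ∧ b < k)
      (hab : a + 1 < b ∨ b + 1 < a) :
      BrauerRel ω (freeSigma K k a ha * freeSigma K k b hb)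
        (freeSigma K k b hb * freeSigma K k a ha)
  | comm_eps_eps (a b : ℕ) (ha : 1 ≤ a ∧ a < k) (hb : 1 ≤ b ∧ b < k)
      (hab : a + 1 < b ∨ b + 1 < a) :
      BrauerRel ω (freeEps K k a ha * freeEps K k b hb) (freeEps K k b hb * freeEps K k a ha)
  | comm_sigma_eps (a b : ℕ) (ha : 1 ≤ a ∧ a < k) (hb : 1 ≤ b ∧ b < k)
      (hab : a + 1 < b ∨ b + 1 < a) :
      BrauerRel ω (freeSigma K k a ha * freeEps K k b hb)
        (freeEps K k b hb * freeSigma K k a ha)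
  | braid (a : ℕ) (h : 1 ≤ a ∧ a < k) (h' : 1 ≤ a + 1 ∧ a + 1 < k) :
      BrauerRel ω (freeSigma K k a h * freeSigma K k (a + 1) h' * freeSigma K k a h)
        (freeSigma K k (a + 1) h' * freeSigma K k a h * freeSigma K k (a + 1) h')
  | eps_eps_eps (a : ℕ) (h : 1 ≤ a ∧ a < k) (h' : 1 ≤ a + 1 ∧ a + 1 < k) :
      BrauerRel ω (freeEps K k a h * freeEps K k (a + 1) h' * freeEps K k a h)
        (freeEps K k a h)
  | eps_eps_eps' (a : ℕ) (h : 1 ≤ a ∧ a < k) (h' : 1 ≤ a + 1 ∧ a + 1 < k) :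
      BrauerRel ω (freeEps K k (a + 1) h' * freeEps K k a h * freeEps K k (a + 1) h')
        (freeEps K k (a + 1) h')
  | sigma_eps_eps (a : ℕ) (h : 1 ≤ a ∧ a < k) (h' : 1 ≤ a + 1 ∧ a + 1 < k) :
      BrauerRel ω (freeSigma K k a h * freeEps K k (a + 1) h' * freeEps K k a h)
        (freeSigma K k (a + 1) h' * freeEps K k a h)
  | eps_eps_sigma (a : ℕ) (h : 1 ≤ a ∧ a < k) (h' : 1 ≤ a + 1 ∧ a + 1 < k) :
      BrauerRel ω (freeEps K k (a + 1) h' * freeEps K k a h * freeSigma K k (a + 1) h')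
        (freeEps K k (a + 1) h' * freeSigma K k a h)

/-- The Brauer algebra with `k` strands and parameter `ω`. -/
abbrev Brauer (ω : K) : Type _ := RingQuot (BrauerRel K k ω)

variable (ω : K)

/-- `σ_a`, `1 ≤ a ≤ k - 1` (a dummy value for other `a`). -/
def sig (a : ℕ) : Brauer K k ω :=
  if h : 1 ≤ a ∧ a < k then RingQuot.mkAlgHom K (BrauerRel K k ω) (freeSigma K k a h) else 1

/-- `ε_a`, `1 ≤ a ≤ k - 1` (a dummy value for other `a`). -/
def eps (a : ℕ) : Brauer K k ω :=
  if h : 1 ≤ a ∧ a < k then RingQuot.mkAlgHom K (BrauerRel K k ω) (freeEps K k a h) else 0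

/-- The cycle `τ_{ab} = σ_a σ_{a+1} ⋯ σ_{b-1}`, `a ≤ b`. -/
def cyc (a b : ℕ) : Brauer K k ω := ((List.range' a (b - a)).map (sig K k ω)).prod

/-- The inverse `τ_{ab}⁻¹ = σ_{b-1} ⋯ σ_{a+1} σ_a`, `a ≤ b`. -/
def cycInv (a b : ℕ) : Brauer K k ω := ((List.range' a (b - a)).reverse.map (sig K k ω)).prod

/-- `σ_{ab} = τ_{a,b-1} σ_{b-1} τ_{a,b-1}⁻¹`, `a < b`. -/
def sigPair (a b : ℕ) : Brauer K k ω :=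
  cyc K k ω a (b - 1) * sig K k ω (b - 1) * cycInv K k ω a (b - 1)

/-- `ε_{ab} = τ_{a,b-1} ε_{b-1} τ_{a,b-1}⁻¹`, `a < b`. -/
def epsPair (a b : ℕ) : Brauer K k ω :=
  cyc K k ω a (b - 1) * eps K k ω (b - 1) * cycInv K k ω a (b - 1)

/-- The elements `y_b = ∑_{a=1}^{b-1} (σ_{ab} - ε_{ab})`. -/
def jucys (b : ℕ) : Brauer K k ω :=
  ∑ a ∈ Finset.Ico 1 b, (sigPair K k ω a b - epsPair K k ω a b)

/-- The symmetrizer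
`s_{(k)} = (1/k!) ∏_{b=2}^k (y_b + 1)(y_b + ω + b - 3) / (2b + ω - 4)`,
the factors being ordered by increasing `b`. -/
def symmetrizer : Brauer K k ω :=
  ((k.factorial : K))⁻¹ •
    ((List.range' 2 (k - 1)).map fun b : ℕ =>
      (2 * (b : K) + ω - 4)⁻¹ •
        ((jucys K k ω b + 1) * (jucys K k ω b + algebraMap K _ (ω + (b : K) - 3)))).prod

end Brauer

/-! ### The symplectic index set and the operators `P_q`, `Q_q`, `C_q` -/

section Symplectic

/-- The index set `{-r, …, -1, 1, …, r}`. -/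
abbrev SympIndex (r : ℕ) : Type := {i : ℤ // i ∈ (Finset.Icc (-(r : ℤ)) r).erase 0}

/-- The index `-i`. -/
def negIdx {r : ℕ} (i : SympIndex r) : SympIndex r :=
  ⟨-i.1, by
    have h := i.2
    simp only [Finset.mem_erase, Finset.mem_Icc] at h ⊢
    omega⟩

variable {K : Type*} [Field K] {r : ℕ}

/-- The sign `ε_i` of the index `i`. -/
def sgn (K : Type*) [Field K] {r : ℕ} (i : SympIndex r) : K := if 0 < i.1 then 1 else -1

/-- The conditions on the family of parameters `(q_{ij}, q_i)`: `(q_{ij})` is a parameter matrix,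
`q_i ≠ 0`, `q_{-i} = q_i⁻¹` and `q_{-i,j} = q_{ij}⁻¹ q_j²`. -/
structure IsTypeCFamily (q : SympIndex r → SympIndex r → K) (v : SympIndex r → K) : Prop where
  param : IsParameterMatrix q
  ne_zero : ∀ i, v i ≠ 0
  neg : ∀ i, v (negIdx i) = (v i)⁻¹
  neg_left : ∀ i j, q (negIdx i) j = (q i j)⁻¹ * v j ^ 2

variable {V : Type*} [AddCommGroup V] [Module K V]

/-- `Q_q = ∑ ε_i ε_j q_i q_j⁻¹ E_i^j ⊗ E_{-i}^{-j}`. -/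
def opQ (e : Module.Basis (SympIndex r) K V) (v : SympIndex r → K) : Module.End K (V ⊗[K] V) :=
  ∑ i, ∑ j, (sgn K i * sgn K j * v i * (v j)⁻¹) •
    TensorProduct.map (unitOp e i j) (unitOp e (negIdx i) (negIdx j))

/-- `C_q = (1 - P_q)/2 - Q_q/(2r)`. -/
def opC (e : Module.Basis (SympIndex r) K V) (q : SympIndex r → SympIndex r → K)
    (v : SympIndex r → K) : Module.End K (V ⊗[K] V) :=
  (2 : K)⁻¹ • (1 - permOp e q) - (2 * (r : K))⁻¹ • opQ e v

end Symplectic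

/-! ### The homomorphism of quadratic algebras given by a Manin matrix -/

section ManinHom

variable {K : Type*} [Field K] {V : Type*} [AddCommGroup V] [Module K V]

theorem entry₂_one_sub {ι : Type*} [DecidableEq ι] (e : Module.Basis ι K V)
    (A : Module.End K (V ⊗[K] V)) (i j l m : ι) :
    entry₂ e (1 - A) i j l m =
      (if l = i then if m = j then 1 else 0 else 0) - entry₂ e A i j l m := by
  simp only [entry₂, LinearMap.sub_apply, Module.End.one_apply, map_sub, Finsupp.sub_apply,
    Module.Basis.tensorProduct_repr_tmul_apply, Module.Basis.repr_self, Finsupp.single_apply,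
    smul_eq_mul]
  split_ifs <;> simp_all

variable {ι : Type*} [Fintype ι] [DecidableEq ι]

theorem psi_mul_psi (e : Module.Basis ι K V) (A : Module.End K (V ⊗[K] V)) (l m : ι) :
    psi e A l * psi e A m = ∑ i, ∑ j, entry₂ e A i j l m • (psi e A i * psi e A j) := by
  have h := RingQuot.mkAlgHom_rel K (XiRel.rel (e := e) (A := A) l m)
  rw [map_zero] at h
  rw [← sub_eq_zero, ← h]
  simp [entry₂_one_sub, sub_smul, psi]

variable (e : Module.Basis ι K V) (A : Module.End K (V ⊗[K] V))
  {W : Type*} [AddCommGroup W] [Module K W] {κ : Type*} [Fintype κ] [DecidableEq κ]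
  (e' : Module.Basis κ K W) (A' : Module.End K (W ⊗[K] W))
  {R : Type*} [Ring R] [Algebra K R]

theorem maninHom_aux (M : Matrix ι κ R) (hM : IsManin e A e' A' M) (γ δ : κ) :
    ∑ α, ∑ β, entry₂ e' (1 - A') α β γ δ •
      ((∑ i, M i α ⊗ₜ[K] psi e A i) * (∑ i, M i β ⊗ₜ[K] psi e A i)) = 0 := by
  have key : ∀ α β, (∑ i, M i α ⊗ₜ[K] psi e A i) * (∑ i, M i β ⊗ₜ[K] psi e A i) =
      ∑ p : ι × ι, (∑ l, ∑ m, entry₂ e A p.1 p.2 l m • (M l α * M m β)) ⊗ₜ[K]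
        (psi e A p.1 * psi e A p.2) := by
    intro α β
    have h1 : ∀ l m : ι, (M l α * M m β) ⊗ₜ[K] (psi e A l * psi e A m) =
        ∑ p : ι × ι, (entry₂ e A p.1 p.2 l m • (M l α * M m β)) ⊗ₜ[K]
          (psi e A p.1 * psi e A p.2) := by
      intro l m
      rw [psi_mul_psi e A l m, Fintype.sum_prod_type]
      simp only [TensorProduct.tmul_sum, TensorProduct.tmul_smul, TensorProduct.smul_tmul']
    rw [Finset.sum_mul_sum]
    simp only [Algebra.TensorProduct.tmul_mul_tmul, TensorProduct.sum_tmul]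
    rw [Finset.sum_comm]
    simp_rw [h1]
    rw [Finset.sum_comm]
    simp_rw [Finset.sum_comm (s := (Finset.univ : Finset ι)) (t := (Finset.univ : Finset (ι × ι)))]
  simp_rw [key, Finset.smul_sum]
  simp_rw [Finset.sum_comm (s := (Finset.univ : Finset κ)) (t := (Finset.univ : Finset (ι × ι)))]
  refine Finset.sum_eq_zero fun p _ => ?_
  simp only [TensorProduct.smul_tmul', ← TensorProduct.sum_tmul]
  suffices hs : ∑ α, ∑ β, entry₂ e' (1 - A') α β γ δ •
      ∑ l, ∑ m, entry₂ e A p.1 p.2 l m • (M l α * M m β) = 0 by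
    rw [hs, TensorProduct.zero_tmul]
  have h := hM p.1 p.2 γ δ
  rw [← sub_eq_zero] at h
  rw [← h]
  simp only [entry₂_one_sub, sub_smul, Finset.sum_sub_distrib, ite_smul, one_smul, zero_smul]
  congr 1
  · simp
  · simp only [Finset.smul_sum, smul_smul]
    rw [← Fintype.sum_prod_type', ← Fintype.sum_prod_type']
    simp only [← Fintype.sum_prod_type']
    exact Fintype.sum_equiv
      ⟨fun x => (x.1.2, x.2, x.1.1.1, x.1.1.2), fun y => (((y.2.2.1, y.2.2.2), y.1), y.2.1),
        fun _ => rfl, fun _ => rfl⟩ _ _ fun x => by rw [mul_comm (entry₂ e' A' _ _ _ _)]; rfl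

/-- The homomorphism `f^M : Ξ_{A'} → R ⊗ Ξ_A`, `ψ_α ↦ ∑ i, M^i_α ψ_i`, of a Manin matrix `M`. -/
def maninHom (M : Matrix ι κ R) (hM : IsManin e A e' A' M) : Xi e' A' →ₐ[K] R ⊗[K] Xi e A :=
  RingQuot.liftAlgHom K ⟨FreeAlgebra.lift K fun α => ∑ i, M i α ⊗ₜ[K] psi e A i, by
    rintro _ _ ⟨γ, δ⟩
    simpa using maninHom_aux e A e' A' M hM γ δ⟩

end ManinHom

/-! ### Minors through the pairing -/

section MinorPairing

variable {K : Type*} [Field K] {V : Type*} [AddCommGroup V] [Module K V]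
  {ι : Type*} [Fintype ι] [DecidableEq ι]
  (e : Module.Basis ι K V) (A : Module.End K (V ⊗[K] V))
  {W : Type*} [AddCommGroup W] [Module K W] {κ : Type*} [Fintype κ] [DecidableEq κ]
  (e' : Module.Basis κ K W) (A' : Module.End K (W ⊗[K] W))
  {R : Type*} [Ring R] [Algebra K R]

/-- The extension to `R ⊗ (Ξ_A)_k`, with values in `R`, of the functional `⟨x, ·⟩` of a pairing
`B` between the `k`-th components of `Ξ*_A` and `Ξ_A`. -/
def pairR {k : ℕ} (B : XiStarDeg e A k →ₗ[K] XiDeg e A k →ₗ[K] K) (x : XiStarDeg e A k) :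
    R ⊗[K] XiDeg e A k →ₗ[K] R :=
  (TensorProduct.rid K R).toLinearMap ∘ₗ LinearMap.lTensor R (B x)

/-- The entries of `T M^{(1)} ⋯ M^{(k)}` are the values `⟨ψ^{i_1} ⋯ ψ^{i_k}, f^M(ψ_{α_1} ⋯ ψ_{α_k})⟩`
of the pairing `B`. Here `g` is the `k`-th component of `f^M`. -/
def MinorsArePairing {k : ℕ} (T : Module.End K (⨂[K] _ : Fin k, V))
    (B : XiStarDeg e A k →ₗ[K] XiDeg e A k →ₗ[K] K) (M : Matrix ι κ R)
    (hM : IsManin e A e' A' M) : Prop :=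
  ∃ g : XiDeg e' A' k →ₗ[K] R ⊗[K] XiDeg e A k,
    (∀ x, LinearMap.lTensor R (XiDeg e A k).subtype (g x) =
      maninHom e A e' A' M hM (x : Xi e' A')) ∧
    ∀ (I : Fin k → ι) (α : Fin k → κ),
      minorA e T M I α = pairR e A B (psiStarDeg e A I) (g (psiDeg e' A' α))

end MinorPairing

/-! ### The representation of the Brauer algebra -/

section Rep

section General

variable {K : Type*} [Field K] {V : Type*} [AddCommGroup V] [Module K V]
  {ι : Type*} [Fintype ι] [DecidableEq ι] (e : Module.Basis ι K V)

theorem unitOp_apply {ι : Type*} [DecidableEq ι] (e : Module.Basis ι K V) (i j l : ι) :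
    unitOp e i j (e l) = if l = j then e i else 0 := by
  simp [unitOp, Finsupp.single_apply]

theorem tbasis_apply {ι : Type*} (e : Module.Basis ι K V) {k : ℕ} (f : Fin k → ι) :
    tbasis e k f = tvec e f := by
  simp [tbasis, tvec]

theorem siteOp_tvec (T : Module.End K (V ⊗[K] V)) {k : ℕ} {a b : Fin k} (hab : a ≠ b)
    (f : Fin k → ι) :
    siteOp e T a b (tvec e f) = ∑ i, ∑ j, entry₂ e T i j (f a) (f b) •
      tvec e (Function.update (Function.update f a i) b j) := by
  have h : ∀ i j l m : ι, PiTensorProduct.map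
      (Function.update (Function.update (fun _ : Fin k => (1 : Module.End K V)) a (unitOp e i l))
        b (unitOp e j m)) (tvec e f) =
      if l = f a then if m = f b then
        tvec e (Function.update (Function.update f a i) b j) else 0 else 0 := by
    intro i j l m
    rw [tvec, PiTensorProduct.map_tprod]
    split_ifs with h1 h2
    · subst h1 h2
      rw [tvec]
      congr 1
      funext t
      by_cases hb : t = b
      · subst hb; simp [unitOp_apply]
      · by_cases ha : t = a
        · subst ha; simp [unitOp_apply, hb]
        · simp [ha, hb]
    · refine MultilinearMap.map_coord_zero _ b ?_
      simp [unitOp_apply, Ne.symm h2]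
    · refine MultilinearMap.map_coord_zero _ a ?_
      simp [unitOp_apply, Ne.symm h1, hab]
  simp only [siteOp, LinearMap.sum_apply, LinearMap.smul_apply, h, smul_ite, smul_zero]
  simp

theorem entry₂_permOp (q : ι → ι → K) (i j l m : ι) :
    entry₂ e (permOp e q) i j l m = if i = m then if j = l then q l m else 0 else 0 := by
  simp only [entry₂, permOp, LinearMap.sum_apply, LinearMap.smul_apply, TensorProduct.map_tmul,
    unitOp_apply, map_sum, map_smul, Finsupp.coe_finsetSum, Finset.sum_apply, Finsupp.smul_apply]
  rw [Finset.sum_eq_single l, Finset.sum_eq_single m]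
  · by_cases h1 : i = m <;> by_cases h2 : j = l <;> simp [h1, h2]
  all_goals simp +contextual [eq_comm]

theorem siteOp_permOp (q : ι → ι → K) {k : ℕ} {a b : Fin k} (hab : a ≠ b) (f : Fin k → ι) :
    siteOp e (permOp e q) a b (tvec e f) = q (f a) (f b) •
      tvec e (Function.update (Function.update f a (f b)) b (f a)) := by
  simp [siteOp_tvec e _ hab, entry₂_permOp]

end General

variable {K : Type*} [Field K] {r : ℕ} {V : Type*} [AddCommGroup V] [Module K V]
  (e : Module.Basis (SympIndex r) K V)

theorem negIdx_negIdx (i : SympIndex r) : negIdx (negIdx i) = i := by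
  simp [negIdx]

theorem sgn_negIdx (i : SympIndex r) : sgn K (negIdx i) = -sgn K i := by
  have h := i.2
  simp only [Finset.mem_erase, Finset.mem_Icc] at h
  change (if 0 < -i.1 then (1 : K) else -1) = -(if 0 < i.1 then (1 : K) else -1)
  by_cases hi : 0 < i.1
  · rw [if_neg (show ¬ 0 < -i.1 by omega), if_pos hi]
  · rw [if_pos (show 0 < -i.1 by omega), if_neg hi, neg_neg]

theorem sgn_mul_self (i : SympIndex r) : sgn K i * sgn K i = 1 := by
  unfold sgn; split_ifs <;> simp

theorem card_sympIndex : Fintype.card (SympIndex r) = 2 * r := by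
  rw [Fintype.card_coe, Finset.card_erase_of_mem (by simp), Int.card_Icc]
  omega

theorem entry₂_opQ (v : SympIndex r → K) (i j l m : SympIndex r) :
    entry₂ e (opQ e v) i j l m = if m = negIdx l then if j = negIdx i then
      sgn K i * sgn K l * v i * (v l)⁻¹ else 0 else 0 := by
  simp only [entry₂, opQ, LinearMap.sum_apply, LinearMap.smul_apply, TensorProduct.map_tmul,
    unitOp_apply, map_sum, map_smul, Finsupp.coe_finsetSum, Finset.sum_apply, Finsupp.smul_apply]
  rw [Finset.sum_eq_single i, Finset.sum_eq_single l]
  · by_cases h1 : m = negIdx l <;> by_cases h2 : j = negIdx i <;> simp [h1, h2]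
  · intro x _ hx
    simp [Ne.symm hx]
  · simp
  · intro x _ hx
    refine Finset.sum_eq_zero fun y _ => ?_
    by_cases hy : l = y <;> simp [hx, hy]
  · simp

theorem siteOp_opQ (v : SympIndex r → K) {k : ℕ} {a b : Fin k} (hab : a ≠ b)
    (f : Fin k → SympIndex r) :
    siteOp e (opQ e v) a b (tvec e f) = if f b = negIdx (f a) then
      ∑ i, (sgn K i * sgn K (f a) * v i * (v (f a))⁻¹) •
        tvec e (Function.update (Function.update f a i) b (negIdx i)) else 0 := by
  rw [siteOp_tvec e _ hab]
  split_ifs with h <;> simp [entry₂_opQ, h]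

theorem siteOp_comm {ι : Type*} [Fintype ι] [DecidableEq ι] (e : Module.Basis ι K V)
    (S T : Module.End K (V ⊗[K] V)) {k : ℕ} {a b c d : Fin k} (hab : a ≠ b) (hcd : c ≠ d)
    (hac : a ≠ c) (had : a ≠ d) (hbc : b ≠ c) (hbd : b ≠ d) :
    siteOp e S a b * siteOp e T c d = siteOp e T c d * siteOp e S a b := by
  refine (tbasis e k).ext fun f => ?_
  have hS : ∀ g : Fin k → ι, siteOp e S a b (tvec e g) = ∑ p : ι × ι,
      entry₂ e S p.1 p.2 (g a) (g b) • tvec e (Function.update (Function.update g a p.1) b p.2) :=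
    fun g => by rw [siteOp_tvec e S hab, Fintype.sum_prod_type]
  have hT : ∀ g : Fin k → ι, siteOp e T c d (tvec e g) = ∑ p : ι × ι,
      entry₂ e T p.1 p.2 (g c) (g d) • tvec e (Function.update (Function.update g c p.1) d p.2) :=
    fun g => by rw [siteOp_tvec e T hcd, Fintype.sum_prod_type]
  simp only [tbasis_apply, Module.End.mul_apply, hS, hT, map_sum, map_smul, Finset.smul_sum,
    smul_smul, Function.update_of_ne hac, Function.update_of_ne had, Function.update_of_ne hbc,
    Function.update_of_ne hbd, Function.update_of_ne hac.symm, Function.update_of_ne had.symm,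
    Function.update_of_ne hbc.symm, Function.update_of_ne hbd.symm]
  rw [Finset.sum_comm]
  refine Finset.sum_congr rfl fun p _ => Finset.sum_congr rfl fun p' _ => ?_
  rw [mul_comm]
  congr 2
  funext t
  simp only [Function.update_apply]
  grind

section Relations

variable {q : SympIndex r → SympIndex r → K} {v : SympIndex r → K} {k : ℕ} {a b c : Fin k}

theorem permOp_sq (h : IsTypeCFamily q v) (hab : a ≠ b) :
    siteOp e (permOp e q) a b * siteOp e (permOp e q) a b = 1 := by
  refine (tbasis e k).ext fun f => ?_
  simp only [tbasis_apply, Module.End.mul_apply, siteOp_permOp e _ hab, map_smul, smul_smul,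
    Module.End.one_apply]
  simp only [Function.update_self, Function.update_of_ne hab]
  rw [h.param.inv (f a) (f b), inv_mul_cancel₀ (h.param.ne_zero _ _), one_smul]
  congr 1
  funext t
  by_cases hb : t = b
  · subst hb; simp
  · by_cases ha : t = a
    · subst ha; simp [hb]
    · simp [ha, hb]

theorem opQ_sq (h : IsTypeCFamily q v) (hab : a ≠ b) :
    siteOp e (opQ e v) a b * siteOp e (opQ e v) a b = (2 * (r : K)) • siteOp e (opQ e v) a b := by
  refine (tbasis e k).ext fun f => ?_
  simp only [tbasis_apply, Module.End.mul_apply, siteOp_opQ e _ hab, LinearMap.smul_apply]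
  split_ifs with hf
  · simp only [map_sum, map_smul, siteOp_opQ e _ hab, Function.update_self,
      Function.update_of_ne hab, if_true]
    simp only [Finset.smul_sum, smul_smul]
    rw [Finset.sum_comm]
    refine Finset.sum_congr rfl fun j _ => ?_
    have : ∀ i : SympIndex r, (sgn K i * sgn K (f a) * v i * (v (f a))⁻¹ *
      (sgn K j * sgn K i * v j * (v i)⁻¹)) • tvec e (Function.update (Function.update
        (Function.update (Function.update f a i) b (negIdx i)) a j) b (negIdx j)) =
      (sgn K j * sgn K (f a) * v j * (v (f a))⁻¹) • tvec e (Function.update (Function.update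
        f a j) b (negIdx j)) := by
      intro i
      congr 1
      · have := h.ne_zero i
        have := h.ne_zero (f a)
        field_simp
        linear_combination (sgn K (f a) * v j * sgn K j) * sgn_mul_self (K := K) i
      · congr 1
        funext t
        by_cases hb : t = b
        · subst hb; simp
        · by_cases ha : t = a
          · subst ha; simp [hb]
          · simp [ha, hb]
    simp only [this, Finset.sum_const, Finset.card_univ, card_sympIndex]
    rw [← Nat.cast_smul_eq_nsmul K, smul_smul]
    push_cast
    rfl
  · simp

theorem permOp_opQ (h : IsTypeCFamily q v) (hab : a ≠ b) :
    siteOp e (permOp e q) a b * siteOp e (opQ e v) a b = -siteOp e (opQ e v) a b := by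
  refine (tbasis e k).ext fun f => ?_
  simp only [tbasis_apply, Module.End.mul_apply, siteOp_opQ e _ hab, LinearMap.neg_apply]
  split_ifs with hf
  · simp only [map_sum, map_smul, siteOp_permOp e _ hab, Function.update_self,
      Function.update_of_ne hab, smul_smul, ← Finset.sum_neg_distrib, ← neg_smul]
    refine Fintype.sum_equiv ⟨negIdx, negIdx, negIdx_negIdx, negIdx_negIdx⟩ _ _ fun i => ?_
    simp only [Equiv.coe_fn_mk, negIdx_negIdx, sgn_negIdx, h.neg]
    congr 1
    · have hq : q i (negIdx i) = (v i)⁻¹ ^ 2 := by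
        rw [h.param.inv, h.neg_left, h.param.diag, inv_one, one_mul, inv_pow]
      have := h.ne_zero i
      have := h.ne_zero (f a)
      rw [hq]
      field_simp
    · congr 1
      funext t
      simp only [Function.update_apply]
      grind
  · simp

theorem opQ_permOp (h : IsTypeCFamily q v) (hab : a ≠ b) :
    siteOp e (opQ e v) a b * siteOp e (permOp e q) a b = -siteOp e (opQ e v) a b := by
  refine (tbasis e k).ext fun f => ?_
  simp only [tbasis_apply, Module.End.mul_apply, siteOp_permOp e _ hab, map_smul,
    siteOp_opQ e _ hab, LinearMap.neg_apply, Function.update_self, Function.update_of_ne hab]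
  by_cases hf : f b = negIdx (f a)
  · have hf' : f a = negIdx (f b) := by rw [hf, negIdx_negIdx]
    rw [if_pos hf, if_pos hf', Finset.smul_sum, ← Finset.sum_neg_distrib]
    refine Finset.sum_congr rfl fun i _ => ?_
    rw [smul_smul, ← neg_smul, hf, sgn_negIdx, h.neg]
    congr 1
    · have hq : q (f a) (negIdx (f a)) = (v (f a))⁻¹ ^ 2 := by
        rw [h.param.inv, h.neg_left, h.param.diag, inv_one, one_mul, inv_pow]
      have := h.ne_zero (f a)
      rw [hq]
      field_simp
    · congr 1
      funext t
      simp only [Function.update_apply]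
      grind
  · have hf' : ¬ f a = negIdx (f b) := fun h' => hf (by rw [h', negIdx_negIdx])
    simp [hf, hf']

theorem permOp_braid (hab : a ≠ b) (hbc : b ≠ c) (hac : a ≠ c) :
    siteOp e (permOp e q) a b * siteOp e (permOp e q) b c * siteOp e (permOp e q) a b =
      siteOp e (permOp e q) b c * siteOp e (permOp e q) a b * siteOp e (permOp e q) b c := by
  refine (tbasis e k).ext fun f => ?_
  simp only [tbasis_apply, Module.End.mul_apply, siteOp_permOp e _ hab, siteOp_permOp e _ hbc,
    map_smul, smul_smul, Function.update_self, Function.update_of_ne hab,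
    Function.update_of_ne hbc, Function.update_of_ne hac,
    Function.update_of_ne hbc.symm, Function.update_of_ne hac.symm]
  congr 1
  · ring
  · congr 1
    funext t
    simp only [Function.update_apply]
    grind

theorem opQ_opQ_opQ (h : IsTypeCFamily q v) (hab : a ≠ b) (hbc : b ≠ c) (hac : a ≠ c) :
    siteOp e (opQ e v) a b * siteOp e (opQ e v) b c * siteOp e (opQ e v) a b =
      siteOp e (opQ e v) a b := by
  refine (tbasis e k).ext fun f => ?_
  simp only [tbasis_apply, Module.End.mul_apply, siteOp_opQ e _ hab]
  split_ifs with hf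
  · simp only [map_sum, map_smul, siteOp_opQ e _ hbc, Function.update_self, negIdx_negIdx,
      Function.update_of_ne hac.symm, Function.update_of_ne hbc.symm]
    rw [Finset.sum_eq_single (f c)]
    · rw [if_pos rfl]
      simp only [map_sum, map_smul, siteOp_opQ e _ hab, Function.update_self,
        Function.update_of_ne hab, Function.update_of_ne hac, Function.update_of_ne hbc]
      rw [Finset.sum_eq_single (negIdx (f c))]
      · rw [if_pos rfl, Finset.smul_sum, Finset.smul_sum]
        refine Finset.sum_congr rfl fun j _ => ?_
        rw [smul_smul, smul_smul]
        congr 1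
        · have := h.ne_zero (f a)
          have := h.ne_zero (f c)
          simp only [sgn_negIdx, h.neg]
          field_simp
          linear_combination (v j * sgn K (f a) * sgn K j * (sgn K (f c) ^ 2 + 1)) *
            sgn_mul_self (K := K) (f c)
        · congr 1
          funext t
          simp only [Function.update_apply, negIdx_negIdx]
          grind
      · intro j _ hj
        rw [if_neg hj, smul_zero]
      · simp
    · intro j _ hj
      rw [if_neg (Ne.symm hj), map_zero, smul_zero]
    · simp
  · simp

theorem opQ_opQ_opQ' (h : IsTypeCFamily q v) (hab : a ≠ b) (hbc : b ≠ c) (hac : a ≠ c) :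
    siteOp e (opQ e v) b c * siteOp e (opQ e v) a b * siteOp e (opQ e v) b c =
      siteOp e (opQ e v) b c := by
  refine (tbasis e k).ext fun f => ?_
  simp only [tbasis_apply, Module.End.mul_apply, siteOp_opQ e _ hbc]
  split_ifs with hf
  · simp only [map_sum, map_smul, siteOp_opQ e _ hab, Function.update_self,
      Function.update_of_ne hac, Function.update_of_ne hab, Function.update_of_ne hbc]
    rw [Finset.sum_eq_single (negIdx (f a))]
    · rw [if_pos rfl]
      simp only [map_sum, map_smul, siteOp_opQ e _ hbc, Function.update_self, negIdx_negIdx,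
        Function.update_of_ne hac.symm, Function.update_of_ne hbc.symm]
      rw [Finset.sum_eq_single (f a)]
      · rw [if_pos rfl, Finset.smul_sum, Finset.smul_sum]
        refine Finset.sum_congr rfl fun j _ => ?_
        rw [smul_smul, smul_smul]
        congr 1
        · have := h.ne_zero (f a)
          have := h.ne_zero (f b)
          simp only [sgn_negIdx, h.neg]
          field_simp
          linear_combination (v j * sgn K (f b) * sgn K j * (sgn K (f a) ^ 2 + 1)) *
            sgn_mul_self (K := K) (f a)
        · congr 1
          funext t
          simp only [Function.update_apply]
          grind
      · intro j _ hj
        rw [if_neg (Ne.symm hj), smul_zero]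
      · simp
    · intro j _ hj
      rw [if_neg hj, map_zero, smul_zero]
    · simp
  · simp

theorem permOp_opQ_opQ (h : IsTypeCFamily q v) (hab : a ≠ b) (hbc : b ≠ c) (hac : a ≠ c) :
    siteOp e (permOp e q) a b * siteOp e (opQ e v) b c * siteOp e (opQ e v) a b =
      -(siteOp e (permOp e q) b c * siteOp e (opQ e v) a b) := by
  refine (tbasis e k).ext fun f => ?_
  simp only [tbasis_apply, Module.End.mul_apply, siteOp_opQ e _ hab, LinearMap.neg_apply]
  split_ifs with hf
  · simp only [map_sum, map_smul, siteOp_opQ e _ hbc, siteOp_permOp e _ hbc,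
      Function.update_self, negIdx_negIdx,
      Function.update_of_ne hac.symm, Function.update_of_ne hbc.symm]
    rw [Finset.sum_eq_single (f c)]
    · rw [if_pos rfl]
      simp only [map_sum, map_smul, siteOp_permOp e _ hab, Function.update_self,
        Function.update_of_ne hab, Function.update_of_ne hac, Function.update_of_ne hbc]
      rw [Finset.smul_sum, ← Finset.sum_neg_distrib]
      refine Finset.sum_congr rfl fun j _ => ?_
      rw [smul_smul, smul_smul, smul_smul, ← neg_smul]
      congr 1
      · have := h.ne_zero (f a)
        have := h.ne_zero (f c)
        have := h.param.ne_zero (f c) j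
        simp only [sgn_negIdx, h.neg, h.neg_left, h.param.inv j (f c), inv_inv]
        field_simp
        linear_combination (-(v j * sgn K (f a) * sgn K j)) *
            sgn_mul_self (K := K) (f c)
      · congr 1
        funext t
        simp only [Function.update_apply]
        grind
    · intro j _ hj
      rw [if_neg (Ne.symm hj), map_zero, smul_zero]
    · simp
  · simp

theorem opQ_opQ_permOp (h : IsTypeCFamily q v) (hab : a ≠ b) (hbc : b ≠ c) (hac : a ≠ c) :
    siteOp e (opQ e v) b c * siteOp e (opQ e v) a b * siteOp e (permOp e q) b c =
      -(siteOp e (opQ e v) b c * siteOp e (permOp e q) a b) := by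
  refine (tbasis e k).ext fun f => ?_
  simp only [tbasis_apply, Module.End.mul_apply, siteOp_permOp e _ hbc, siteOp_permOp e _ hab,
    map_smul, siteOp_opQ e _ hab, siteOp_opQ e _ hbc, LinearMap.neg_apply,
    Function.update_self, Function.update_of_ne hab, Function.update_of_ne hac,
    Function.update_of_ne hbc, Function.update_of_ne hac.symm, Function.update_of_ne hbc.symm]
  split_ifs with hf
  · simp only [map_sum, map_smul, siteOp_opQ e _ hbc, Function.update_self, negIdx_negIdx,
      Function.update_of_ne hac.symm, Function.update_of_ne hbc.symm]
    rw [Finset.sum_eq_single (f b)]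
    · rw [if_pos rfl, Finset.smul_sum, Finset.smul_sum, Finset.smul_sum,
        ← Finset.sum_neg_distrib]
      refine Finset.sum_congr rfl fun j _ => ?_
      rw [smul_smul, smul_smul, smul_smul, ← neg_smul]
      congr 1
      · have := h.ne_zero (f a)
        have := h.ne_zero (f b)
        have := h.param.ne_zero (f a) (f b)
        rw [hf, h.param.inv (f b) (negIdx (f a)), h.neg_left]
        simp only [sgn_negIdx, h.neg]
        field_simp
        linear_combination (-(v j * sgn K (f a) * sgn K j)) * sgn_mul_self (K := K) (f b)
      · congr 1
        funext t
        simp only [Function.update_apply]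
        grind
    · intro j _ hj
      rw [if_neg (Ne.symm hj), smul_zero]
    · simp
  · simp

end Relations

variable (q : SympIndex r → SympIndex r → K) (v : SympIndex r → K) (k : ℕ)

/-- The values of the representation on the generators:
`σ_a ↦ -P_q^{(a,a+1)}`, `ε_a ↦ -Q_q^{(a,a+1)}`. The site `a` is the element `a - 1` of `Fin k`. -/
def rhoGen : BrauerGen k → Module.End K (⨂[K] _ : Fin k, V)
  | BrauerGen.sigma a h => -siteOp e (permOp e q) (⟨a - 1, by omega⟩ : Fin k) ⟨a, h.2⟩
  | BrauerGen.eps a h => -siteOp e (opQ e v) (⟨a - 1, by omega⟩ : Fin k) ⟨a, h.2⟩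

theorem rhoGen_rel {q : SympIndex r → SympIndex r → K} {v : SympIndex r → K}
    (h : IsTypeCFamily q v) ⦃x y : FreeAlgebra K (BrauerGen k)⦄
    (hxy : BrauerRel K k (-2 * (r : K)) x y) :
    FreeAlgebra.lift K (rhoGen e q v k) x = FreeAlgebra.lift K (rhoGen e q v k) y := by
  have ne : ∀ (m n : ℕ) (hm : m < k) (hn : n < k), m ≠ n → (⟨m, hm⟩ : Fin k) ≠ ⟨n, hn⟩ :=
    fun m n hm hn hmn h => hmn (Fin.mk.inj_iff.1 h)
  have nn : ∀ S T : Module.End K (⨂[K] _ : Fin k, V), -S * -T = S * T :=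
    fun S T => neg_mul_neg S T
  have nm : ∀ S T : Module.End K (⨂[K] _ : Fin k, V), S * -T = -(S * T) :=
    fun S T => mul_neg S T
  induction hxy with
  | sigma_sq a ha =>
    simp only [freeSigma, freeEps, map_mul, map_one, FreeAlgebra.lift_ι_apply, rhoGen, nn]
    exact permOp_sq e h (ne _ _ _ _ (by omega))
  | eps_sq a ha =>
    simp only [freeSigma, freeEps, map_mul, map_smul, FreeAlgebra.lift_ι_apply, rhoGen, nn]
    rw [opQ_sq e h (ne _ _ _ _ (by omega))]
    module
  | sigma_eps a ha =>
    simp only [freeSigma, freeEps, map_mul, FreeAlgebra.lift_ι_apply, rhoGen, nn]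
    exact permOp_opQ e h (ne _ _ _ _ (by omega))
  | eps_sigma a ha =>
    simp only [freeSigma, freeEps, map_mul, FreeAlgebra.lift_ι_apply, rhoGen, nn]
    exact opQ_permOp e h (ne _ _ _ _ (by omega))
  | comm_sigma_sigma a b ha hb hab =>
    simp only [freeSigma, freeEps, map_mul, FreeAlgebra.lift_ι_apply, rhoGen, nn]
    apply siteOp_comm <;> exact ne _ _ _ _ (by omega)
  | comm_eps_eps a b ha hb hab =>
    simp only [freeSigma, freeEps, map_mul, FreeAlgebra.lift_ι_apply, rhoGen, nn]
    apply siteOp_comm <;> exact ne _ _ _ _ (by omega)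
  | comm_sigma_eps a b ha hb hab =>
    simp only [freeSigma, freeEps, map_mul, FreeAlgebra.lift_ι_apply, rhoGen, nn]
    apply siteOp_comm <;> exact ne _ _ _ _ (by omega)
  | braid a ha ha' =>
    simp only [freeSigma, freeEps, map_mul, FreeAlgebra.lift_ι_apply, rhoGen, nn, nm, neg_inj,
      Nat.add_sub_cancel]
    exact permOp_braid e (ne (a - 1) a _ _ (by omega)) (ne a (a + 1) _ _ (by omega)) (ne (a - 1) (a + 1) _ _ (by omega))
  | eps_eps_eps a ha ha' =>
    simp only [freeSigma, freeEps, map_mul, FreeAlgebra.lift_ι_apply, rhoGen, nn, nm, neg_inj,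
      Nat.add_sub_cancel]
    exact opQ_opQ_opQ e h (ne (a - 1) a _ _ (by omega)) (ne a (a + 1) _ _ (by omega)) (ne (a - 1) (a + 1) _ _ (by omega))
  | eps_eps_eps' a ha ha' =>
    simp only [freeSigma, freeEps, map_mul, FreeAlgebra.lift_ι_apply, rhoGen, nn, nm, neg_inj,
      Nat.add_sub_cancel]
    exact opQ_opQ_opQ' e h (ne (a - 1) a _ _ (by omega)) (ne a (a + 1) _ _ (by omega)) (ne (a - 1) (a + 1) _ _ (by omega))
  | sigma_eps_eps a ha ha' =>
    simp only [freeSigma, freeEps, map_mul, FreeAlgebra.lift_ι_apply, rhoGen, nn, nm,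
      Nat.add_sub_cancel]
    rw [neg_eq_iff_eq_neg]
    exact permOp_opQ_opQ e h (ne (a - 1) a _ _ (by omega)) (ne a (a + 1) _ _ (by omega))
      (ne (a - 1) (a + 1) _ _ (by omega))
  | eps_eps_sigma a ha ha' =>
    simp only [freeSigma, freeEps, map_mul, FreeAlgebra.lift_ι_apply, rhoGen, nn, nm,
      Nat.add_sub_cancel]
    rw [neg_eq_iff_eq_neg]
    exact opQ_opQ_permOp e h (ne (a - 1) a _ _ (by omega)) (ne a (a + 1) _ _ (by omega))
      (ne (a - 1) (a + 1) _ _ (by omega))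

/-- The representation `ρ_q` of the Brauer algebra with parameter `-2r` on the `k`-th tensor
power of `V`. -/
def rho {q : SympIndex r → SympIndex r → K} {v : SympIndex r → K} (h : IsTypeCFamily q v) :
    Brauer K k (-2 * (r : K)) →ₐ[K] Module.End K (⨂[K] _ : Fin k, V) :=
  RingQuot.liftAlgHom K ⟨FreeAlgebra.lift K (rhoGen e q v k), rhoGen_rel e k h⟩

/-- The operator `C_{q,(k)} = ρ_q(s_{(k)})`. -/
def opCk {q : SympIndex r → SympIndex r → K} {v : SympIndex r → K} (h : IsTypeCFamily q v) :
    Module.End K (⨂[K] _ : Fin k, V) :=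
  rho e k h (symmetrizer K k (-2 * (r : K)))

end Rep

end

end ManinC

/-! Under `rho`, with `ω = -2r`, the operator `C_q` in two neighbouring sites is the image of `(1 +
σ_a)/2 - ω⁻¹ ε_a`, the symmetrizer on two strands. The pairing axioms for `ρ(s_(k))` thus become two
statements about Brauer relations, proved for arbitrary elements `s a`, `e a` of an algebra
(`IsBrauerSystem`).

Absorption (`left_symm`, `right_symm`): `σ_a s_(k) = s_(k) = s_(k) σ_a` and `ε_a s_(k) = 0 = s_(k)
ε_a`. The induction adds one strand. Let `u` be the smaller symmetrizer, `y` the new Jucys–Murphy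
element and `ε`, `σ` the new generators. The previous Jucys–Murphy element acts on `u` by a scalar,
so `ε y u` is a multiple of `ε u`, and the factor `y + ω + b - 3` is exactly the one that makes `ε`
vanish. Once every `ε_a` kills the product, the factor `y + 1` makes it invariant under `σ`, as for
the symmetric group. Right absorption follows because the relations are stable under reversal of
products.

Normalization (`map_symm_mul`): a linear map that ignores left factors `σ_a` and kills left factors
`ε_a` sees `y_b` as `b - 1`. Each factor of `s_(k)` then becomes `b (2b + ω - 4)` before division,
and the denominators give `1`. They are nonzero for `ω = -2r` exactly because `k ≤ r + 1`. Applied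
to `T ↦ (Ψ ⊗ ⋯ ⊗ Ψ) T` and, reversed, to `T ↦ T (Ψ* ⊗ ⋯ ⊗ Ψ*)`, this yields the remaining axioms.

The rest holds for every pairing operator `T`. The identities with `1 - A` say that the entries of
`T` respect the quadratic relations in both multi-indices, so they define a pairing
(`exists_pairing`); the identities with `Ψ` and `Ψ*` expand each element through its values under
the pairing, hence non-degeneracy. The formula for minors is the expansion of `f^M` on monomials
(`minorsArePairing`). -/

namespace ManinC

/-! ### Brauer systems -/

section BrauerSystem

variable {K : Type*} [Field K] {A : Type*} [Ring A] [Algebra K A]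

/-- Elements `s a`, `e a`, `a < N`, of an algebra that satisfy the relations of the Brauer algebra
with parameter `ω` on `N + 1` strands. The list of relations is closed under reversal of
products. -/
structure IsBrauerSystem (ω : K) (N : ℕ) (s e : ℕ → A) : Prop where
  s_s : ∀ {a}, a < N → s a * s a = 1
  e_e : ∀ {a}, a < N → e a * e a = ω • e a
  s_e : ∀ {a}, a < N → s a * e a = e a
  e_s : ∀ {a}, a < N → e a * s a = e a
  comm_s_s : ∀ {a b}, a + 1 < b → b < N → s a * s b = s b * s a
  comm_e_e : ∀ {a b}, a + 1 < b → b < N → e a * e b = e b * e a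
  comm_s_e : ∀ {a b}, a + 1 < b → b < N → s a * e b = e b * s a
  comm_e_s : ∀ {a b}, a + 1 < b → b < N → e a * s b = s b * e a
  braid : ∀ {a}, a + 1 < N → s a * s (a + 1) * s a = s (a + 1) * s a * s (a + 1)
  s_e_e : ∀ {a}, a + 1 < N → s a * e (a + 1) * e a = s (a + 1) * e a
  e_e_s : ∀ {a}, a + 1 < N → e a * e (a + 1) * s a = e a * s (a + 1)
  s_e_e' : ∀ {a}, a + 1 < N → s (a + 1) * e a * e (a + 1) = s a * e (a + 1)
  e_e_s' : ∀ {a}, a + 1 < N → e (a + 1) * e a * s (a + 1) = e (a + 1) * s a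

/-- The Jucys–Murphy elements `jm n = y_{n+1}`. -/
def jm (s e : ℕ → A) : ℕ → A
  | 0 => 0
  | n + 1 => s n * jm s e n * s n + s n - e n

/-- The symmetrizer on `n + 1` strands. -/
noncomputable def symm (ω : K) (s e : ℕ → A) : ℕ → A
  | 0 => 1
  -- Here `b = n + 2`, so `2b + ω - 4 = 2n + ω` and `ω + b - 3 = ω + n - 1`; the factor `n + 2` is
  -- the contribution of this step to `k!`.
  | n + 1 => symm ω s e n * (((n + 2 : K) * (2 * n + ω))⁻¹ •
      ((jm s e (n + 1) + 1) * (jm s e (n + 1) + algebraMap K A (ω + n - 1))))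

namespace IsBrauerSystem

variable {ω : K} {N : ℕ} {s e : ℕ → A}

/-- Passing to the opposite algebra turns each statement about left multiplication into its
right-hand counterpart. -/
theorem op (h : IsBrauerSystem ω N s e) :
    IsBrauerSystem ω N (fun a => MulOpposite.op (s a)) (fun a => MulOpposite.op (e a)) := by
  constructor <;> intros <;> simp only [← MulOpposite.op_mul, ← mul_assoc] <;>
    first
    | exact congrArg _ (h.s_s ‹_›)
    | exact congrArg _ (h.e_e ‹_›)
    | exact congrArg _ (h.s_e ‹_›)
    | exact congrArg _ (h.e_s ‹_›)
    | exact congrArg _ (h.comm_s_s ‹_› ‹_›).symm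
    | exact congrArg _ (h.comm_e_e ‹_› ‹_›).symm
    | exact congrArg _ (h.comm_s_e ‹_› ‹_›).symm
    | exact congrArg _ (h.comm_e_s ‹_› ‹_›).symm
    | exact congrArg _ (h.braid ‹_›)
    | exact congrArg _ (h.s_e_e ‹_›)
    | exact congrArg _ (h.e_e_s ‹_›)
    | exact congrArg _ (h.s_e_e' ‹_›)
    | exact congrArg _ (h.e_e_s' ‹_›)

/-- Both sides are bracketings of `s a * e (a + 1) * e a * s (a + 1)`. -/
theorem conj_e (h : IsBrauerSystem ω N s e) {a : ℕ} (ha : a + 1 < N) :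
    s a * e (a + 1) * s a = s (a + 1) * e a * s (a + 1) := by
  have h1 := h.s_e_e ha
  have h2 := h.e_e_s' ha
  rw [← h1, mul_assoc, mul_assoc, mul_assoc, ← mul_assoc (e (a + 1)), h2]

theorem commute_jm_of_lt (h : IsBrauerSystem ω N s e) {n b : ℕ} (hn : n < b) (hb : b < N) :
    Commute (s b) (jm s e n) ∧ Commute (e b) (jm s e n) := by
  induction n with
  | zero => exact ⟨Commute.zero_right _, Commute.zero_right _⟩
  | succ n ih =>
    obtain ⟨h1, h2⟩ := ih (by omega)
    have a1 : Commute (s b) (s n) := (h.comm_s_s hn hb).symm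
    have a2 : Commute (s b) (e n) := (h.comm_e_s hn hb).symm
    have a3 : Commute (e b) (s n) := (h.comm_s_e hn hb).symm
    have a4 : Commute (e b) (e n) := (h.comm_e_e hn hb).symm
    exact ⟨(((a1.mul_right h1).mul_right a1).add_right a1).sub_right a2,
      (((a3.mul_right h2).mul_right a3).add_right a3).sub_right a4⟩

/-- Conjugation by a generator on the first `n + 1` strands should only permute the summands of
`y_{n+2}`. The recursion for `jm` shows this directly unless the generator is the adjacent one, `a +
1 = n`; that case unfolds two levels of the recursion. -/
theorem commute_jm (h : IsBrauerSystem ω N s e) {n a : ℕ} (ha : a < n) (hn : n < N) :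
    Commute (s a) (jm s e (n + 1)) ∧ Commute (e a) (jm s e (n + 1)) := by
  induction n with
  | zero => omega
  | succ n ih =>
    rcases Nat.lt_succ_iff_lt_or_eq.1 ha with ha' | rfl
    · obtain ⟨h1, h2⟩ := ih ha' (by omega)
      have a1 : Commute (s a) (s (n + 1)) := h.comm_s_s (by omega) hn
      have a2 : Commute (s a) (e (n + 1)) := h.comm_s_e (by omega) hn
      have a3 : Commute (e a) (s (n + 1)) := h.comm_e_s (by omega) hn
      have a4 : Commute (e a) (e (n + 1)) := h.comm_e_e (by omega) hn
      exact ⟨(((a1.mul_right h1).mul_right a1).add_right a1).sub_right a2,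
        (((a3.mul_right h2).mul_right a3).add_right a3).sub_right a4⟩
    · obtain ⟨c, c'⟩ := h.commute_jm_of_lt (Nat.lt_succ_self a) hn
      have hy := c.eq
      have hy' := c'.eq
      have ss := h.s_s (show a < N by omega)
      have tt := h.s_s hn
      have es := h.e_s (show a < N by omega)
      have se := h.s_e (show a < N by omega)
      have br := h.braid hn
      have cj := h.conj_e hn
      have ees := h.e_e_s hn
      have see := h.s_e_e hn
      -- The braid relation and `conj_e` rewrite `t (s - e) t` as `s (t - f) s`, where `t`, `f` are
      -- the generators at `a + 1`. Conjugation by `s` then exchanges the last two terms.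
      have e1 : jm s e (a + 1 + 1) = s (a + 1) * s a * jm s e a * s a * s (a + 1) +
          s a * (s (a + 1) - e (a + 1)) * s a + (s (a + 1) - e (a + 1)) := by
        simp only [jm, mul_sub, sub_mul, mul_add, add_mul, mul_assoc] at br cj ⊢
        rw [← br, ← cj]
        abel
      have p1 : s a * s (a + 1) * s a = s (a + 1) * s a * s (a + 1) := br
      have p2 : e a * s (a + 1) * s a = s (a + 1) * s a * e (a + 1) := by
        calc e a * s (a + 1) * s a = (s (a + 1) * s (a + 1)) * e a * s (a + 1) * s a := by
              rw [tt, one_mul]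
          _ = s (a + 1) * (s (a + 1) * e a * s (a + 1)) * s a := by noncomm_ring
          _ = s (a + 1) * s a * e (a + 1) * (s a * s a) := by rw [← cj]; noncomm_ring
          _ = _ := by rw [ss, mul_one]
      have p3 : s a * s (a + 1) * e a = e (a + 1) * s a * s (a + 1) := by
        calc s a * s (a + 1) * e a = s a * (s (a + 1) * e a * s (a + 1)) * s (a + 1) := by
              simp only [mul_assoc, tt, mul_one]
          _ = (s a * s a) * e (a + 1) * s a * s (a + 1) := by rw [← cj]; noncomm_ring
          _ = _ := by rw [ss, one_mul]
      generalize jm s e a = y at *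
      generalize s (a + 1) = t at *
      generalize e (a + 1) = f at *
      generalize s a = s at *
      generalize e a = e at *
      constructor
      · rw [e1, commute_iff_eq]
        have q : s * (t * s * y * s * t) = (t * s * y * s * t) * s := by
          calc s * (t * s * y * s * t) = (s * t * s) * y * s * t := by noncomm_ring
            _ = t * s * (t * y) * s * t := by rw [p1]; noncomm_ring
            _ = t * s * y * (t * s * t) := by rw [hy]; noncomm_ring
            _ = _ := by rw [← p1]; noncomm_ring
        linear_combination (norm := noncomm_ring) q + ss * (t - f) * s - s * (t - f) * ss
      · rw [e1, commute_iff_eq]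
        have q : e * (t * s * y * s * t) = (t * s * y * s * t) * e := by
          calc e * (t * s * y * s * t) = (e * t * s) * y * s * t := by noncomm_ring
            _ = t * s * (f * y) * s * t := by rw [p2]; noncomm_ring
            _ = t * s * y * (f * s * t) := by rw [hy']; noncomm_ring
            _ = _ := by rw [← p3]; noncomm_ring
        have ef : e * f = e * t * s := by
          rw [← ees, mul_assoc, ss, mul_one]
        have fe : f * e = s * t * e := by
          rw [mul_assoc, ← see, mul_assoc, ← mul_assoc s s, ss, one_mul]
        linear_combination (norm := noncomm_ring)
          q + es * (t - f) * s - ees - ef - s * (t - f) * se + see + fe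

/-- Next to the cap `e n`, a transposition ending on one of its strands equals a contraction ending
on the other: `ε_{bc} σ_{ac} = ε_{bc} ε_{ab}`. Exchanging the two strands therefore changes the sign
of each `σ_{ab} - ε_{ab}`. -/
theorem e_mul_jm_mul (h : IsBrauerSystem ω N s e) {n : ℕ} (hn : n < N) :
    e n * jm s e n * (s n + 1) = 0 := by
  induction n with
  | zero => simp [jm]
  | succ n ih =>
    have ih := ih (by omega)
    obtain ⟨c, c'⟩ := h.commute_jm_of_lt (Nat.lt_succ_self n) hn
    have hy := c.eq
    have tt := h.s_s hn
    have br := h.braid hn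
    have ees := h.e_e_s' hn
    rw [jm]
    generalize jm s e n = y at *
    generalize s (n + 1) = t at *
    generalize e (n + 1) = f at *
    generalize s n = s at *
    generalize e n = e at *
    have q : f * s * y * s * t = - (f * s * y * s) := by
      calc f * s * y * s * t = f * e * (t * y) * s * t := by rw [← ees]; noncomm_ring
        _ = f * e * y * (t * s * t) := by rw [hy]; noncomm_ring
        _ = f * (e * y * (s + 1)) * t * s - f * e * (y * t) * s := by rw [← br]; noncomm_ring
        _ = _ := by rw [ih, ← hy, ← ees]; noncomm_ring
    linear_combination (norm := noncomm_ring) q - ees * t - ees + f * e * tt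

theorem e_mul_jm_succ (h : IsBrauerSystem ω N s e) {n : ℕ} (hn : n < N) :
    e n * jm s e (n + 1) = (1 - ω) • e n - e n * jm s e n := by
  have h1 := h.e_mul_jm_mul hn
  have h2 := h.e_s hn
  have h3 := h.e_e hn
  rw [jm, sub_smul, one_smul, ← h3]
  linear_combination (norm := noncomm_ring) h1 + h2 * jm s e n * s n + h2

theorem jm_mul_of_fixed {n : ℕ} {x : A} (hs : ∀ a < n, s a * x = x) (he : ∀ a < n, e a * x = 0) :
    jm s e n * x = (n : K) • x := by
  induction n with
  | zero => simp [jm]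
  | succ n ih =>
    have ih := ih (fun a ha => hs a (by omega)) (fun a ha => he a (by omega))
    have h1 := hs n (by omega)
    rw [jm, sub_mul, add_mul, mul_assoc, h1, he n (by omega), mul_assoc, ih, mul_smul_comm, h1]
    push_cast
    module

/-- For transpositions this is `(a b)(b c) = (a c)(a b) = (b c)(a c)`: on a vector symmetric in the
first strands, `σ_{ab} σ_{bc}` and `σ_{ac}` agree and the result is invariant under `σ_{bc}`. The
contractions contribute nothing. The induction is applied to `s (n + 1) * x`, which satisfies the
hypotheses one level down. -/
theorem s_mul_jm_mul_s_mul (h : IsBrauerSystem ω N s e) {n : ℕ} (hn : n < N) {x : A}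
    (hs : ∀ a < n, s a * x = x) (he : ∀ a ≤ n, e a * x = 0) :
    s n * (jm s e n * (s n * x)) = jm s e n * (s n * x) := by
  induction n generalizing x with
  | zero => simp [jm]
  | succ n ih =>
    have ss := h.s_s hn
    have br := h.braid hn
    have cj := h.conj_e hn
    have tt := h.s_s (show n < N by omega)
    have hsn := hs n (by omega)
    have hen := he n (by omega)
    have hen1 := he (n + 1) le_rfl
    -- Replace `x` by `s n * x`; then `e n` slides through `s (n + 1) * s n` and becomes `e (n +
    -- 1)`.
    have e1 : e n * (s (n + 1) * x) = 0 := by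
      have : e n * s (n + 1) * s n = s (n + 1) * s n * e (n + 1) := by
        linear_combination (norm := noncomm_ring) s (n + 1) * cj.symm * s n -
          ss * e n * s (n + 1) * s n + s (n + 1) * s n * e (n + 1) * tt
      rw [← hsn, ← mul_assoc (s (n + 1)), ← mul_assoc (e n), ← mul_assoc (e n), this, mul_assoc,
        hen1, mul_zero]
    have ih := ih (by omega) (x := s (n + 1) * x)
      (fun a ha => by
        rw [← mul_assoc, h.comm_s_s (by omega) hn, mul_assoc, hs a (by omega)])
      (fun a ha => by
        rcases ha.lt_or_eq with ha | rfl
        · rw [← mul_assoc, h.comm_e_s (by omega) hn, mul_assoc, he a (by omega), mul_zero]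
        · exact e1)
    have hy := (h.commute_jm_of_lt (Nat.lt_succ_self n) hn).1.eq
    rw [jm]
    generalize jm s e n = y at *
    generalize s (n + 1) = t at *
    generalize e (n + 1) = f at *
    generalize s n = s at *
    generalize e n = e at *
    have k1 : t * (s * (t * x)) = s * (t * x) := by
      linear_combination (norm := noncomm_ring) s * t * hsn - br * x
    have k2 : t * (y * (s * (t * x))) = y * (s * (t * x)) := by
      rw [← mul_assoc, hy, mul_assoc, k1]
    rw [sub_mul, add_mul, e1, sub_zero, mul_assoc, mul_assoc, ih, mul_add, k1, k2]

/-- The left annihilation properties of the symmetrizer pass from `n` to `n + 1` strands. -/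
theorem fixed_step (h : IsBrauerSystem ω N s e) {n : ℕ} (hn : n < N) {u : A}
    (hs : ∀ a < n, s a * u = u) (he : ∀ a < n, e a * u = 0)
    (hc : Commute (jm s e (n + 1)) u) {a : ℕ} (ha : a ≤ n) :
    s a * ((jm s e (n + 1) + 1) * ((jm s e (n + 1) + algebraMap K A (ω + n - 1)) * u)) =
        (jm s e (n + 1) + 1) * ((jm s e (n + 1) + algebraMap K A (ω + n - 1)) * u) ∧
      e a * ((jm s e (n + 1) + 1) * ((jm s e (n + 1) + algebraMap K A (ω + n - 1)) * u)) = 0 := by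
  set y := jm s e (n + 1) with hy
  set c := algebraMap K A (ω + n - 1) with hcdef
  have hcc : ∀ z : A, Commute z c := fun z => (Algebra.commutes _ z).symm
  have hX : (y + c) * u = u * (y + c) := (hc.add_left (hcc u).symm).eq
  have hyc : (y + 1) * (y + c) = (y + c) * (y + 1) :=
    (((Commute.refl y).add_left (Commute.one_left y)).add_right (hcc (y + 1))).eq
  have hu1 : (y + 1) * u = u * (y + 1) := (hc.add_left (Commute.one_left u)).eq
  have hXs : ∀ b < n, s b * ((y + c) * u) = (y + c) * u := fun b hb => by
    rw [hX, ← mul_assoc, hs b hb]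
  have hXe : ∀ b < n, e b * ((y + c) * u) = 0 := fun b hb => by
    rw [hX, ← mul_assoc, he b hb, zero_mul]
  -- The origin of the constant `c`: since `jm n` acts on `u` as `n`, `e_mul_jm_succ` gives `e n * y
  -- * u = (1 - ω - n) • (e n * u)`, and `c = ω + n - 1` cancels this.
  have hXn : e n * ((y + c) * u) = 0 := by
    have h1 := h.e_mul_jm_succ hn
    have h2 := jm_mul_of_fixed (K := K) (s := s) (e := e) hs he
    rw [← mul_assoc, mul_add, h1, sub_add_eq_add_sub, sub_mul, mul_assoc, h2, add_mul,
      mul_assoc (e n) c, hcdef, ← Algebra.smul_def, mul_smul_comm, smul_mul_assoc, mul_smul_comm]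
    module
  -- The factor `y + 1` commutes with `y + c` and with `u`, so it can be moved to the far right, out
  -- of the way of `e n`.
  have hE : e n * ((y + 1) * ((y + c) * u)) = 0 := by
    rw [← mul_assoc (y + 1), hyc, mul_assoc, hu1, ← mul_assoc (y + c), ← mul_assoc, hXn, zero_mul]
  rcases ha.lt_or_eq with ha | rfl
  · obtain ⟨c1, c2⟩ := h.commute_jm ha hn
    rw [← hy] at c1 c2
    constructor
    · rw [← mul_assoc, (c1.add_right (Commute.one_right _)).eq, mul_assoc, hXs a ha]
    · rw [← mul_assoc, (c2.add_right (Commute.one_right _)).eq, mul_assoc, hXe a ha, mul_zero]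
  · refine ⟨?_, hE⟩
    set x := (y + c) * u
    -- Since `e a` kills `x`, `(y + 1) * x` is `s (jm a) s x` plus `s x + x`. The second part is
    -- visibly invariant under `s a`; the first is by this lemma.
    have k := h.s_mul_jm_mul_s_mul hn hXs fun b hb => by
      rcases hb.lt_or_eq with hb | rfl
      exacts [hXe b hb, hXn]
    have ss := h.s_s hn
    have se := h.s_e hn
    rw [hy, jm]
    linear_combination (norm := noncomm_ring) ss * (jm s e a * s a * x) + ss * x - se * x - k

theorem commute_jm_symm {z : A} {n : ℕ}
    (hz : ∀ a < n, Commute (s a) z ∧ Commute (e a) z) :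
    Commute (jm s e n) z ∧ Commute (symm ω s e n) z := by
  induction n with
  | zero => exact ⟨Commute.zero_left _, Commute.one_left _⟩
  | succ n ih =>
    obtain ⟨h1, h2⟩ := ih fun a ha => hz a (by omega)
    obtain ⟨h3, h4⟩ := hz n (by omega)
    have hj : Commute (jm s e (n + 1)) z := (((h3.mul_left h1).mul_left h3).add_left h3).sub_left h4
    exact ⟨hj, h2.mul_left (((hj.add_left (Commute.one_left _)).mul_left
      (hj.add_left (Algebra.commutes _ z))).smul_left _)⟩

/-- The factors commute, so the new one may stand on the left, the form that `fixed_step` handles.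
-/
theorem symm_succ (h : IsBrauerSystem ω N s e) {n : ℕ} (hn : n < N) :
    symm ω s e (n + 1) = ((n + 2 : K) * (2 * n + ω))⁻¹ • ((jm s e (n + 1) + 1) *
      ((jm s e (n + 1) + algebraMap K A (ω + n - 1)) * symm ω s e n)) := by
  have hc := (commute_jm_symm (ω := ω) fun a ha => h.commute_jm ha hn).2
  rw [symm, mul_smul_comm, ← mul_assoc (jm s e (n + 1) + 1), ((hc.add_right
    (Commute.one_right _)).mul_right (hc.add_right (Algebra.commutes _ _).symm)).eq]

theorem left_symm (h : IsBrauerSystem ω N s e) {n : ℕ} (hn : n ≤ N) {a : ℕ} (ha : a < n) :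
    s a * symm ω s e n = symm ω s e n ∧ e a * symm ω s e n = 0 := by
  induction n generalizing a with
  | zero => omega
  | succ n ih =>
    have hc := (commute_jm_symm (ω := ω) fun a ha => h.commute_jm ha hn).2
    obtain ⟨h1, h2⟩ := h.fixed_step hn (fun a ha => (ih (by omega) ha).1)
      (fun a ha => (ih (by omega) ha).2) hc.symm (Nat.lt_succ_iff.1 ha)
    rw [h.symm_succ hn, mul_smul_comm, mul_smul_comm, h1, h2, smul_zero]
    exact ⟨rfl, rfl⟩

theorem op_jm (n : ℕ) : jm (fun a => MulOpposite.op (s a)) (fun a => MulOpposite.op (e a)) n =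
    MulOpposite.op (jm s e n) := by
  induction n with
  | zero => rfl
  | succ n ih => simp [jm, ih, mul_assoc]

theorem op_symm (h : IsBrauerSystem ω N s e) {n : ℕ} (hn : n ≤ N) :
    symm ω (fun a => MulOpposite.op (s a)) (fun a => MulOpposite.op (e a)) n =
      MulOpposite.op (symm ω s e n) := by
  induction n with
  | zero => rfl
  | succ n ih =>
    rw [h.symm_succ hn, symm, ih (by omega), op_jm, mul_smul_comm, MulOpposite.op_smul]
    congr 1
    simp only [MulOpposite.op_mul, MulOpposite.op_add, MulOpposite.op_one, mul_assoc]
    congr 1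
    exact (((Commute.refl (MulOpposite.op (jm s e (n + 1)))).add_left
      (Commute.one_left _)).add_right (Algebra.commutes _ _).symm).eq

theorem right_symm (h : IsBrauerSystem ω N s e) {n : ℕ} (hn : n ≤ N) {a : ℕ} (ha : a < n) :
    symm ω s e n * s a = symm ω s e n ∧ symm ω s e n * e a = 0 := by
  obtain ⟨h1, h2⟩ := h.op.left_symm hn ha
  rw [h.op_symm hn, ← MulOpposite.op_mul] at h1 h2
  exact ⟨MulOpposite.op_injective h1, MulOpposite.op_injective h2⟩

/-! ### Linear maps that do not see the symmetrizer -/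

variable {P : Type*} [AddCommGroup P] [Module K P]

theorem map_jm_mul {n : ℕ} (φ : A →ₗ[K] P) (hs : ∀ a < n, ∀ x, φ (s a * x) = φ x)
    (he : ∀ a < n, ∀ x, φ (e a * x) = 0) (x : A) : φ (jm s e n * x) = (n : K) • φ x := by
  induction n generalizing x with
  | zero => simp [jm]
  | succ n ih =>
    rw [jm, sub_mul, add_mul, map_sub, map_add, he n (by omega), mul_assoc, mul_assoc,
      hs n (by omega), hs n (by omega), ih (fun a ha => hs a (by omega))
      (fun a ha => he a (by omega)), hs n (by omega)]
    push_cast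
    module

/-- Under `φ` the element `jm (n + 1)` acts as `n + 1`, so the last factor acts as `(n + 2)(n + 1 +
ω + n - 1) = (n + 2)(2n + ω)`, which its denominator cancels. -/
theorem map_symm_mul [CharZero K] {n : ℕ} (hω : ∀ m < n, 2 * (m : K) + ω ≠ 0) (φ : A →ₗ[K] P)
    (hs : ∀ a < n, ∀ x, φ (s a * x) = φ x) (he : ∀ a < n, ∀ x, φ (e a * x) = 0) (x : A) :
    φ (symm ω s e n * x) = φ x := by
  induction n generalizing x with
  | zero => simp [symm]
  | succ n ih =>
    have h1 : (n : K) + 2 ≠ 0 := by exact_mod_cast (by omega : n + 2 ≠ 0)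
    have h2 := hω n (by omega)
    have hs' := fun x => map_jm_mul φ hs he x
    have hx : ∀ c : K, ∀ z : A,
        φ ((jm s e (n + 1) + algebraMap K A c) * z) = (n + 1 + c) • φ z := fun c z => by
      rw [add_mul, map_add, hs', ← Algebra.smul_def, map_smul]
      push_cast
      module
    have h1x := hx 1
    rw [map_one] at h1x
    rw [symm, mul_assoc, ih (fun m hm => hω m (by omega)) (fun a ha => hs a (by omega))
      (fun a ha => he a (by omega)), smul_mul_assoc, map_smul, mul_assoc, h1x, hx, smul_smul,
      smul_smul]
    convert one_smul K _
    rw [mul_assoc, inv_mul_eq_one₀ (mul_ne_zero h1 h2)]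
    ring

/-- A linear map that is invariant under left multiplication by the symmetrizers on two neighbouring
strands is invariant under the symmetrizer. -/
theorem map_symm_of_left [CharZero K] (h : IsBrauerSystem ω N s e)
    (hω : ∀ m < N, 2 * (m : K) + ω ≠ 0) (φ : A →ₗ[K] P)
    (hφ : ∀ a < N, ∀ x, φ (((2 : K)⁻¹ • (1 + s a) - ω⁻¹ • e a) * x) = φ x) :
    φ (symm ω s e N) = φ 1 := by
  -- The two-strand symmetrizer kills `e a`, because `(1 + s a)/2` fixes it and `ω⁻¹ • e a` does
  -- too. The case `m = 0` of `hω` makes `ω` invertible.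
  have he : ∀ a < N, ∀ x, φ (e a * x) = 0 := fun a ha x => by
    have hω0 : ω ≠ 0 := by simpa using hω 0 (by omega)
    rw [← hφ a ha, ← mul_assoc, sub_mul, smul_mul_assoc, smul_mul_assoc, add_mul, one_mul,
      h.s_e ha, h.e_e ha, smul_smul, inv_mul_cancel₀ hω0, ← two_smul K, smul_smul,
      inv_mul_cancel₀ two_ne_zero, sub_self, zero_mul, map_zero]
  have hs : ∀ a < N, ∀ x, φ (s a * x) = φ x := fun a ha x => by
    have h1 := hφ a ha x
    rw [sub_mul, smul_mul_assoc, smul_mul_assoc, add_mul, one_mul, map_sub, map_smul, map_smul,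
      map_add, he a ha, smul_zero, sub_zero, inv_smul_eq_iff₀ two_ne_zero, two_smul] at h1
    exact add_left_cancel h1
  simpa using map_symm_mul hω φ hs he 1

theorem map_symm_of_right [CharZero K] (h : IsBrauerSystem ω N s e)
    (hω : ∀ m < N, 2 * (m : K) + ω ≠ 0) (φ : A →ₗ[K] P)
    (hφ : ∀ a < N, ∀ x, φ (x * ((2 : K)⁻¹ • (1 + s a) - ω⁻¹ • e a)) = φ x) :
    φ (symm ω s e N) = φ 1 := by
  have := h.op.map_symm_of_left hω (φ ∘ₗ (MulOpposite.opLinearEquiv K).symm.toLinearMap)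
    fun a ha x => hφ a ha x.unop
  rwa [h.op_symm le_rfl] at this

end IsBrauerSystem

end BrauerSystem
/-! ### Brauer algebra -/

section BrauerAlgebra

variable {K : Type*} [Field K] {k : ℕ} {ω : K}

theorem sig_of_lt {a : ℕ} (h : 1 ≤ a ∧ a < k) :
    sig K k ω a = RingQuot.mkAlgHom K (BrauerRel K k ω) (freeSigma K k a h) := dif_pos h

theorem eps_of_lt {a : ℕ} (h : 1 ≤ a ∧ a < k) :
    eps K k ω a = RingQuot.mkAlgHom K (BrauerRel K k ω) (freeEps K k a h) := dif_pos h

variable (K k ω) in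
-- The presentation contains only two of the four mixed cubic relations of a Brauer system; the
-- other two, `e_e_s` and `s_e_e'`, follow from `ε_a ε_{a+1} = ε_a σ_{a+1} σ_a`.
theorem isBrauerSystem_sig_eps :
    IsBrauerSystem ω (k - 1) (fun a => sig K k ω (a + 1)) (fun a => eps K k ω (a + 1)) := by
  have rel : ∀ {x y}, BrauerRel K k ω x y →
      RingQuot.mkAlgHom K (BrauerRel K k ω) x = RingQuot.mkAlgHom K (BrauerRel K k ω) y :=
    fun h => RingQuot.mkAlgHom_rel K h
  have lt : ∀ {a}, a < k - 1 → 1 ≤ a + 1 ∧ a + 1 < k := fun h => by omega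
  have ss : ∀ {a}, a < k - 1 → sig K k ω (a + 1) * sig K k ω (a + 1) = 1 := fun ha => by
    simpa [sig_of_lt (lt ha)] using rel (.sigma_sq _ (lt ha))
  have es : ∀ {a}, a < k - 1 → eps K k ω (a + 1) * sig K k ω (a + 1) = eps K k ω (a + 1) :=
    fun ha => by
      simpa [sig_of_lt (lt ha), eps_of_lt (lt ha)] using rel (.eps_sigma _ (lt ha))
  have efe : ∀ {a}, a + 1 < k - 1 → eps K k ω (a + 1) * eps K k ω (a + 1 + 1) *
      eps K k ω (a + 1) = eps K k ω (a + 1) := fun {a} ha => by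
    have h1 := lt (show a < k - 1 by omega)
    simpa [eps_of_lt h1, eps_of_lt (lt ha)] using rel (.eps_eps_eps _ h1 (lt ha))
  have sfe : ∀ {a}, a + 1 < k - 1 → sig K k ω (a + 1) * eps K k ω (a + 1 + 1) *
      eps K k ω (a + 1) = sig K k ω (a + 1 + 1) * eps K k ω (a + 1) := fun {a} ha => by
    have h1 := lt (show a < k - 1 by omega)
    simpa [sig_of_lt h1, sig_of_lt (lt ha), eps_of_lt h1, eps_of_lt (lt ha)] using
      rel (.sigma_eps_eps _ h1 (lt ha))
  have fet : ∀ {a}, a + 1 < k - 1 → eps K k ω (a + 1 + 1) * eps K k ω (a + 1) *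
      sig K k ω (a + 1 + 1) = eps K k ω (a + 1 + 1) * sig K k ω (a + 1) := fun {a} ha => by
    have h1 := lt (show a < k - 1 by omega)
    simpa [sig_of_lt h1, sig_of_lt (lt ha), eps_of_lt h1, eps_of_lt (lt ha)] using
      rel (.eps_eps_sigma _ h1 (lt ha))
  have cj : ∀ {a}, a + 1 < k - 1 → sig K k ω (a + 1 + 1) * eps K k ω (a + 1) *
      sig K k ω (a + 1 + 1) = sig K k ω (a + 1) * eps K k ω (a + 1 + 1) * sig K k ω (a + 1) :=
    fun ha => by rw [← sfe ha, mul_assoc, mul_assoc, ← mul_assoc (eps K k ω _), fet ha, mul_assoc]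
  have ete : ∀ {a}, a + 1 < k - 1 → eps K k ω (a + 1) * sig K k ω (a + 1 + 1) *
      eps K k ω (a + 1) = eps K k ω (a + 1) := fun {a} ha => by
    have h1 := es (show a < k - 1 by omega)
    rw [mul_assoc, ← sfe ha, ← mul_assoc, ← mul_assoc, h1, efe ha]
  have hf : ∀ {a}, a + 1 < k - 1 → eps K k ω (a + 1 + 1) = sig K k ω (a + 1) *
      sig K k ω (a + 1 + 1) * eps K k ω (a + 1) * sig K k ω (a + 1 + 1) * sig K k ω (a + 1) :=
    fun {a} ha => by
      have h1 := ss (show a < k - 1 by omega)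
      calc _ = (sig K k ω (a + 1) * sig K k ω (a + 1)) * eps K k ω (a + 1 + 1) *
            (sig K k ω (a + 1) * sig K k ω (a + 1)) := by rw [h1, one_mul, mul_one]
        _ = sig K k ω (a + 1) * (sig K k ω (a + 1) * eps K k ω (a + 1 + 1) * sig K k ω (a + 1)) *
            sig K k ω (a + 1) := by simp only [mul_assoc]
        _ = _ := by rw [← cj ha]; simp only [mul_assoc]
  -- Insert the conjugate form of `ε_{a+1}`, absorb `σ_a` into `ε_a`, and contract `ε_a σ_{a+1} ε_a`
  -- to `ε_a`.
  have ef : ∀ {a}, a + 1 < k - 1 → eps K k ω (a + 1) * eps K k ω (a + 1 + 1) =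
      eps K k ω (a + 1) * sig K k ω (a + 1 + 1) * sig K k ω (a + 1) := fun {a} ha => by
    have h1 := es (show a < k - 1 by omega)
    rw [hf ha]
    linear_combination (norm := noncomm_ring) h1 * sig K k ω (a + 1 + 1) * eps K k ω (a + 1) *
      sig K k ω (a + 1 + 1) * sig K k ω (a + 1) + ete ha * sig K k ω (a + 1 + 1) * sig K k ω (a + 1)
  constructor
  case s_s => exact ss
  case e_s => exact es
  case e_e =>
    intro a ha
    simpa [eps_of_lt (lt ha)] using rel (.eps_sq _ (lt ha))
  case s_e =>
    intro a ha
    simpa [sig_of_lt (lt ha), eps_of_lt (lt ha)] using rel (.sigma_eps _ (lt ha))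
  case comm_s_s =>
    intro a b hab hb
    have h1 := lt (show a < k - 1 by omega)
    simpa [sig_of_lt h1, sig_of_lt (lt hb)] using
      rel (.comm_sigma_sigma _ _ h1 (lt hb) (by omega))
  case comm_e_e =>
    intro a b hab hb
    have h1 := lt (show a < k - 1 by omega)
    simpa [eps_of_lt h1, eps_of_lt (lt hb)] using rel (.comm_eps_eps _ _ h1 (lt hb) (by omega))
  case comm_s_e =>
    intro a b hab hb
    have h1 := lt (show a < k - 1 by omega)
    simpa [sig_of_lt h1, eps_of_lt (lt hb)] using rel (.comm_sigma_eps _ _ h1 (lt hb) (by omega))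
  case comm_e_s =>
    intro a b hab hb
    have h1 := lt (show a < k - 1 by omega)
    simpa [eps_of_lt h1, sig_of_lt (lt hb)] using
      (rel (.comm_sigma_eps _ _ (lt hb) h1 (by omega))).symm
  case braid =>
    intro a ha
    have h1 := lt (show a < k - 1 by omega)
    simpa [sig_of_lt h1, sig_of_lt (lt ha)] using rel (.braid _ h1 (lt ha))
  case s_e_e => exact sfe
  case e_e_s' => exact fet
  case e_e_s =>
    intro a ha
    have h1 := ss (show a < k - 1 by omega)
    rw [ef ha, mul_assoc, h1, mul_one]
  case s_e_e' =>
    intro a ha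
    have h1 := ss (show a < k - 1 by omega)
    rw [mul_assoc, ef ha, ← mul_assoc, ← mul_assoc, cj ha, mul_assoc, h1, mul_one]

/-! ### The elements `σ_{ab}`, `ε_{ab}` and the recursion for the Jucys–Murphy elements -/

theorem cyc_succ_left {a b : ℕ} (h : a < b) :
    cyc K k ω a b = sig K k ω a * cyc K k ω (a + 1) b := by
  obtain ⟨c, rfl⟩ := Nat.exists_eq_add_of_lt h
  have h1 : a + c + 1 - a = c + 1 := by omega
  have h2 : a + c + 1 - (a + 1) = c := by omega
  rw [cyc, cyc, h1, h2, List.range'_succ, List.map_cons, List.prod_cons]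

theorem cycInv_succ_left {a b : ℕ} (h : a < b) :
    cycInv K k ω a b = cycInv K k ω (a + 1) b * sig K k ω a := by
  obtain ⟨c, rfl⟩ := Nat.exists_eq_add_of_lt h
  have h1 : a + c + 1 - a = c + 1 := by omega
  have h2 : a + c + 1 - (a + 1) = c := by omega
  rw [cycInv, cycInv, h1, h2, List.range'_succ, List.reverse_cons, List.map_append,
    List.prod_append, List.map_singleton, List.prod_singleton]

theorem sigPair_self_succ (a : ℕ) : sigPair K k ω a (a + 1) = sig K k ω a := by
  simp [sigPair, cyc, cycInv]

theorem epsPair_self_succ (a : ℕ) : epsPair K k ω a (a + 1) = eps K k ω a := by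
  simp [epsPair, cyc, cycInv]

theorem sigPair_succ_left {a b : ℕ} (h : a + 1 < b) :
    sigPair K k ω a b = sig K k ω a * sigPair K k ω (a + 1) b * sig K k ω a := by
  rw [sigPair, sigPair, cyc_succ_left (by omega), cycInv_succ_left (by omega)]
  simp only [mul_assoc]

theorem epsPair_succ_left {a b : ℕ} (h : a + 1 < b) :
    epsPair K k ω a b = sig K k ω a * epsPair K k ω (a + 1) b * sig K k ω a := by
  rw [epsPair, epsPair, cyc_succ_left (by omega), cycInv_succ_left (by omega)]
  simp only [mul_assoc]

/-- The definition of the pairs moves the left end by conjugation, whereas `jm` moves the right end.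
The two agree by induction on `b - a`: the base is the braid relation and `conj_e`, and in the step
the two outer conjugations commute. -/
theorem pair_succ_right {a b : ℕ} (ha : 1 ≤ a) (hab : a < b) (hb : b < k) :
    sigPair K k ω a (b + 1) = sig K k ω b * sigPair K k ω a b * sig K k ω b ∧
      epsPair K k ω a (b + 1) = sig K k ω b * epsPair K k ω a b * sig K k ω b := by
  have H := isBrauerSystem_sig_eps K k ω
  obtain ⟨d, rfl⟩ := Nat.exists_eq_add_of_lt hab
  induction d generalizing a with
  | zero =>
    obtain ⟨a, rfl⟩ := Nat.exists_eq_add_of_le' ha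
    rw [sigPair_succ_left (by omega), epsPair_succ_left (by omega)]
    simp only [add_zero, sigPair_self_succ, epsPair_self_succ]
    exact ⟨H.braid (by omega), H.conj_e (by omega)⟩
  | succ d ih =>
    obtain ⟨h1, h2⟩ := ih (a := a + 1) (by omega) (by omega) (by omega)
    rw [show a + 1 + d + 1 = a + (d + 1) + 1 by omega] at h1 h2
    obtain ⟨a, rfl⟩ := Nat.exists_eq_add_of_le' ha
    have hc : sig K k ω (a + 1) * sig K k ω (a + 1 + (d + 1) + 1) =
        sig K k ω (a + 1 + (d + 1) + 1) * sig K k ω (a + 1) :=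
      H.comm_s_s (a := a) (b := a + 1 + (d + 1)) (by omega) (by omega)
    have conj : ∀ x, sig K k ω (a + 1) * (sig K k ω (a + 1 + (d + 1) + 1) * x *
        sig K k ω (a + 1 + (d + 1) + 1)) * sig K k ω (a + 1) = sig K k ω (a + 1 + (d + 1) + 1) *
        (sig K k ω (a + 1) * x * sig K k ω (a + 1)) * sig K k ω (a + 1 + (d + 1) + 1) := by
      intro x
      simp only [mul_assoc]
      rw [← hc, ← mul_assoc, hc, mul_assoc]
    rw [sigPair_succ_left (a := a + 1) (b := a + 1 + (d + 1) + 1 + 1) (by omega),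
      epsPair_succ_left (a := a + 1) (b := a + 1 + (d + 1) + 1 + 1) (by omega), h1, h2,
      sigPair_succ_left (a := a + 1) (b := a + 1 + (d + 1) + 1) (by omega),
      epsPair_succ_left (a := a + 1) (b := a + 1 + (d + 1) + 1) (by omega)]
    exact ⟨conj _, conj _⟩

theorem jucys_eq_jm {n : ℕ} (hn : n < k) :
    jucys K k ω (n + 1) = jm (fun a => sig K k ω (a + 1)) (fun a => eps K k ω (a + 1)) n := by
  induction n with
  | zero => simp [jucys, jm]
  | succ n ih =>
    rw [jm, ← ih (by omega), jucys, Finset.sum_Ico_succ_top (by omega), sigPair_self_succ,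
      epsPair_self_succ, jucys, Finset.mul_sum, Finset.sum_mul, add_sub_assoc]
    congr 1
    refine Finset.sum_congr rfl fun a ha => ?_
    rw [Finset.mem_Ico] at ha
    obtain ⟨h1, h2⟩ := pair_succ_right (ω := ω) ha.1 ha.2 hn
    rw [h1, h2, mul_sub, sub_mul]

theorem symmetrizer_eq_symm [CharZero K] (hk : 1 ≤ k) :
    symmetrizer K k ω =
      symm ω (fun a => sig K k ω (a + 1)) (fun a => eps K k ω (a + 1)) (k - 1) := by
  have key : ∀ n < k, (((n + 1).factorial : K))⁻¹ • ((List.range' 2 n).map fun b : ℕ =>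
      (2 * (b : K) + ω - 4)⁻¹ • ((jucys K k ω b + 1) *
        (jucys K k ω b + algebraMap K _ (ω + (b : K) - 3)))).prod =
      symm ω (fun a => sig K k ω (a + 1)) (fun a => eps K k ω (a + 1)) n := by
    intro n hn
    induction n with
    | zero => simp [symm]
    | succ n ih =>
      rw [symm, ← ih (by omega), List.range'_concat, List.map_append, List.prod_append,
        List.map_singleton, List.prod_singleton, one_mul, ← jucys_eq_jm hn,
        show 2 + n = n + 1 + 1 by omega, mul_smul_comm, mul_smul_comm, smul_mul_assoc,
        smul_smul, smul_smul]
      congr 1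
      · rw [Nat.factorial_succ (n + 1)]
        push_cast
        rw [mul_inv, mul_inv]
        ring_nf
      · rw [show ω + ((n + 1 + 1 : ℕ) : K) - 3 = ω + n - 1 by push_cast; ring]
  have := key (k - 1) (by omega)
  rwa [Nat.sub_add_cancel hk] at this

end BrauerAlgebra

/-! ### Linear functionals on quadratic algebras -/

section RingQuotient

variable {K : Type*} [Field K] {B : Type*} [Ring B] [Algebra K B] {P : Type*} [AddCommGroup P]
  [Module K P]

theorem apply_eq_of_mkAlgHom_eq {r : B → B → Prop} (F : B →ₗ[K] P)
    (hF : ∀ a b x y, r x y → F (a * x * b) = F (a * y * b)) {x y : B}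
    (h : RingQuot.mkAlgHom K r x = RingQuot.mkAlgHom K r y) : F x = F y := by
  -- The factors `a`, `b` are needed for the induction, since `RingQuot.Rel` is closed under
  -- multiplication on either side.
  have key : ∀ x y, RingQuot.Rel r x y → ∀ a b, F (a * x * b) = F (a * y * b) := by
    intro x y hxy
    induction hxy with
    | of hxy => exact fun a b => hF a b _ _ hxy
    | add_left _ ih => intro a b; simp only [mul_add, add_mul, map_add, ih]
    | mul_left _ ih => intro a b; simpa only [mul_assoc] using ih a (_ * b)
    | mul_right _ ih => intro a b; simpa only [mul_assoc] using ih (a * _) b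
  have h1 : RingQuot.mkRingHom r x = RingQuot.mkRingHom r y := by
    rw [← RingQuot.mkAlgHom_coe K r]
    exact h
  rw [RingQuot.mkRingHom_def] at h1
  exact congrArg (fun z : RingQuot r => Quot.lift F
    (fun x y hxy => by simpa using key x y hxy 1 1) z.toQuot) h1

theorem exists_linearMap_mkAlgHom {r : B → B → Prop} (F : B →ₗ[K] P)
    (hF : ∀ a b x y, r x y → F (a * x * b) = F (a * y * b)) :
    ∃ f : RingQuot r →ₗ[K] P, ∀ x, f (RingQuot.mkAlgHom K r x) = F x := by
  obtain ⟨g, hg⟩ := (RingQuot.mkAlgHom K r).toLinearMap.exists_rightInverse_of_surjective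
    (LinearMap.range_eq_top.2 (RingQuot.mkAlgHom_surjective K r))
  exact ⟨F ∘ₗ g, fun x => apply_eq_of_mkAlgHom_eq F hF
    (LinearMap.congr_fun hg (RingQuot.mkAlgHom K r x))⟩

end RingQuotient

theorem ofFn_update_update {α : Type*} {k : ℕ} (f : Fin k → α) {a b : Fin k} (hab : (b : ℕ) = a + 1)
    (x y : α) : List.ofFn (Function.update (Function.update f a x) b y) =
      (List.ofFn f).take a ++ ([x, y] ++ (List.ofFn f).drop (a + 2)) := by
  have hb := b.2
  have ha := a.2
  refine List.ext_getElem (by simp; omega) fun i h1 h2 => ?_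
  simp only [List.length_ofFn] at h1
  simp only [List.getElem_ofFn, Function.update_apply, Fin.ext_iff, hab]
  rcases lt_trichotomy i a with hi | rfl | hi
  · rw [if_neg (by omega), if_neg (by omega), List.getElem_append_left (by simp; omega)]
    simp
  · simp
  · rw [List.getElem_append_right (by simp; omega)]
    rcases (Nat.succ_le_of_lt hi).eq_or_lt with hi' | hi'
    · have : i - a = 1 := by omega
      simp [← hi']
    · rw [if_neg (by omega), if_neg (by omega), List.getElem_append_right (by simp; omega)]
      simp only [List.length_take, List.length_ofFn, List.getElem_drop, List.getElem_ofFn,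
        List.length_cons, List.length_nil]
      congr 2
      omega

section Words

variable {K : Type*} [Field K] {ι : Type*} [Fintype ι] [DecidableEq ι] {P : Type*}
  [AddCommGroup P] [Module K P]

/-- A family `G` indexed by the words of length `k` that satisfies the quadratic relations at all
neighbouring positions extends to a linear map on the quadratic algebra. -/
theorem exists_linearMap_quadratic {k : ℕ} (N : ι → ι → ι → ι → K)
    {r : FreeAlgebra K ι → FreeAlgebra K ι → Prop}
    (hr : ∀ x y, r x y → ∃ l m, x = ∑ i, ∑ j, N i j l m •
      (FreeAlgebra.ι K i * FreeAlgebra.ι K j) ∧ y = 0)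
    (G : (Fin k → ι) → P)
    (hG : ∀ a b : Fin k, (b : ℕ) = a + 1 → ∀ J l m,
      ∑ i, ∑ j, N i j l m • G (Function.update (Function.update J a i) b j) = 0) :
    ∃ f : RingQuot r →ₗ[K] P, ∀ J : Fin k → ι,
      f (List.ofFn fun t => RingQuot.mkAlgHom K r (FreeAlgebra.ι K (J t))).prod = G J := by
  set bas := FreeAlgebra.basisFreeMonoid K ι with hbas
  have hbas : ∀ w : FreeMonoid ι, bas w = (w.toList.map (FreeAlgebra.ι K)).prod := fun w => by
    simp [hbas, FreeAlgebra.basisFreeMonoid, FreeAlgebra.equivMonoidAlgebraFreeMonoid,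
      FreeMonoid.lift_apply]
  -- The value is `0` on words of length other than `k`. The relations are homogeneous, so all words
  -- in one instance of a relation have the same length and this extension respects them.
  set G' : List ι → P := fun w => if h : w.length = k then
    G (fun t => w.get (t.cast h.symm)) else 0 with hG'
  have hofFn : ∀ J, G' (List.ofFn J) = G J := fun J => by simp [hG']
  set F : FreeAlgebra K ι →ₗ[K] P := bas.constr K fun w => G' w.toList with hFdef
  have hF : ∀ w : List ι, F (w.map (FreeAlgebra.ι K)).prod = G' w := fun w => by
    have := bas.constr_basis K (fun w => G' w.toList) (FreeMonoid.ofList w)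
    rwa [hbas] at this
  have hword : ∀ (u w : List ι) l m, ∑ i, ∑ j, N i j l m • G' (u ++ ([i, j] ++ w)) = 0 := by
    intro u w l m
    by_cases hk : u.length + 2 + w.length = k
    · have ha : u.length < k := by omega
      have hb : u.length + 1 < k := by omega
      have h := hG ⟨_, ha⟩ ⟨_, hb⟩ rfl
        (fun t => (u ++ ([l, m] ++ w)).get (t.cast (by simp; omega))) l m
      rw [← h]
      refine Finset.sum_congr rfl fun i _ => Finset.sum_congr rfl fun j _ => ?_
      rw [← hofFn, ofFn_update_update _ rfl]
      have : List.ofFn (fun t : Fin k => (u ++ ([l, m] ++ w)).get (t.cast (by simp; omega))) =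
          u ++ ([l, m] ++ w) := by
        refine List.ext_getElem (by simp; omega) fun i h1 h2 => by simp
      rw [this]
      simp
    · refine Finset.sum_eq_zero fun i _ => Finset.sum_eq_zero fun j _ => ?_
      have : G' (u ++ ([i, j] ++ w)) = 0 := dif_neg (by simp; omega)
      rw [this, smul_zero]
  -- By linearity in `a` and in `b` it suffices to take words on both sides of the relation.
  have hrel : ∀ a b x y, r x y → F (a * x * b) = F (a * y * b) := by
    intro a b x y hxy
    obtain ⟨l, m, rfl, rfl⟩ := hr x y hxy
    set x := ∑ i, ∑ j, N i j l m • (FreeAlgebra.ι K i * FreeAlgebra.ι K j) with hx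
    have h1 : ∀ u w, F (bas u * x * bas w) = 0 := fun u w => by
      rw [← hword u.toList w.toList l m, hbas, hbas, hx]
      simp only [Finset.mul_sum, Finset.sum_mul, map_sum, mul_smul_comm, smul_mul_assoc, map_smul]
      refine Finset.sum_congr rfl fun i _ => Finset.sum_congr rfl fun j _ => ?_
      rw [← hF]
      simp [mul_assoc]
    have h2 : ∀ u b, F (bas u * x * b) = 0 := fun u b => by
      have : F ∘ₗ LinearMap.mulLeft K (bas u * x) = 0 := bas.ext fun w => h1 u w
      exact LinearMap.congr_fun this b
    have h3 : F ∘ₗ LinearMap.mulRight K (x * b) = 0 := bas.ext fun u => by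
      simpa [mul_assoc] using h2 u b
    rw [mul_zero, zero_mul, map_zero, mul_assoc]
    exact LinearMap.congr_fun h3 a
  obtain ⟨f, hf⟩ := exists_linearMap_mkAlgHom F hrel
  refine ⟨f, fun J => ?_⟩
  rw [← hofFn, ← hF, ← hf, map_list_prod (RingQuot.mkAlgHom K r), List.map_ofFn, List.map_ofFn]
  rfl

end Words

/-! ### Operators in two sites -/

section SiteOp

variable {K : Type*} [Field K] {V : Type*} [AddCommGroup V] [Module K V]
  {ι : Type*} [Fintype ι] [DecidableEq ι] (e : Module.Basis ι K V) {k : ℕ}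

theorem siteOp_sub (S T : Module.End K (V ⊗[K] V)) (a b : Fin k) :
    siteOp e (S - T) a b = siteOp e S a b - siteOp e T a b := by
  have h : siteOp e (S - T + T) a b = siteOp e (S - T) a b + siteOp e T a b := by
    simp only [siteOp, entry₂, LinearMap.add_apply, map_add, Finsupp.add_apply, add_smul,
      Finset.sum_add_distrib]
  rw [eq_sub_iff_add_eq, ← h, sub_add_cancel]

theorem siteOp_smul (c : K) (T : Module.End K (V ⊗[K] V)) (a b : Fin k) :
    siteOp e (c • T) a b = c • siteOp e T a b := by
  simp [siteOp, entry₂, Finset.smul_sum, mul_smul]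

theorem entry₂_one (i j l m : ι) : entry₂ e (1 : Module.End K (V ⊗[K] V)) i j l m =
    if l = i then if m = j then 1 else 0 else 0 := by
  simpa [entry₂] using entry₂_one_sub e (0 : Module.End K (V ⊗[K] V)) i j l m

theorem siteOp_one {a b : Fin k} (hab : a ≠ b) :
    siteOp e (1 : Module.End K (V ⊗[K] V)) a b = 1 := by
  refine (tbasis e k).ext fun f => ?_
  simp [tbasis_apply, siteOp_tvec e _ hab, entry₂_one]

theorem entry₂_mul (S T : Module.End K (V ⊗[K] V)) (i j l m : ι) :
    entry₂ e (S * T) i j l m = ∑ x, ∑ y, entry₂ e S i j x y * entry₂ e T x y l m := by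
  have h := (e.tensorProduct e).sum_repr (T (e l ⊗ₜ[K] e m))
  simp only [entry₂, Module.End.mul_apply]
  conv_lhs => rw [← h]
  rw [map_sum, map_sum, Finsupp.coe_finsetSum, Finset.sum_apply, Fintype.sum_prod_type]
  simp [mul_comm]

theorem update_update_idem {α β : Type*} [DecidableEq α] {a b : α} (hab : a ≠ b) (f : α → β)
    (x y i j : β) : Function.update (Function.update (Function.update (Function.update f a x)
      b y) a i) b j = Function.update (Function.update f a i) b j := by
  rw [Function.update_comm hab, Function.update_idem, Function.update_comm hab.symm,
    Function.update_idem]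

theorem siteOp_mul (S T : Module.End K (V ⊗[K] V)) {a b : Fin k} (hab : a ≠ b) :
    siteOp e (S * T) a b = siteOp e S a b * siteOp e T a b := by
  refine (tbasis e k).ext fun f => ?_
  simp only [tbasis_apply, Module.End.mul_apply, siteOp_tvec e _ hab, map_sum, map_smul,
    Function.update_self, Function.update_of_ne hab, Finset.smul_sum, smul_smul, entry₂_mul,
    Finset.sum_smul]
  simp only [update_update_idem hab]
  simp only [← Fintype.sum_prod_type', mul_comm]
  exact Fintype.sum_equiv ⟨fun p : ι × ι × ι × ι => (p.2.2.1, p.2.2.2, p.1, p.2.1),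
    fun p => (p.2.2.1, p.2.2.2, p.1, p.2.1), fun _ => rfl, fun _ => rfl⟩ _ _ fun _ => rfl

theorem update_update_eq_iff {α β : Type*} [DecidableEq α] {f g : α → β} {a b : α} (hab : a ≠ b)
    {x y : β} : Function.update (Function.update f a x) b y = g ↔
      x = g a ∧ y = g b ∧ ∀ t, t ≠ a → t ≠ b → f t = g t := by
  constructor
  · rintro rfl
    simp +contextual [hab]
  · rintro ⟨rfl, rfl, h⟩
    funext t
    simp only [Function.update_apply]
    grind

/-- The row form of `siteOp_tvec`: it is what left multiplication by a site operator does to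
entries. -/
theorem repr_siteOp (T : Module.End K (V ⊗[K] V)) {a b : Fin k} (hab : a ≠ b)
    (x : ⨂[K] _ : Fin k, V) (I : Fin k → ι) :
    (tbasis e k).repr (siteOp e T a b x) I = ∑ l, ∑ m, entry₂ e T (I a) (I b) l m *
      (tbasis e k).repr x (Function.update (Function.update I a l) b m) := by
  have h : (tbasis e k).coord I ∘ₗ siteOp e T a b = ∑ l, ∑ m, entry₂ e T (I a) (I b) l m •
      (tbasis e k).coord (Function.update (Function.update I a l) b m) := by
    refine (tbasis e k).ext fun f => ?_
    rw [LinearMap.comp_apply, tbasis_apply, siteOp_tvec e T hab]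
    have comm : (∀ t, t ≠ a → t ≠ b → I t = f t) ↔ ∀ t, t ≠ a → t ≠ b → f t = I t :=
      ⟨fun h t ha hb => (h t ha hb).symm, fun h t ha hb => (h t ha hb).symm⟩
    simp only [← tbasis_apply, map_sum, map_smul, LinearMap.sum_apply, LinearMap.smul_apply,
      Module.Basis.coord_apply, Module.Basis.repr_self, Finsupp.single_apply, smul_eq_mul,
      eq_comm (a := f), update_update_eq_iff hab, comm, mul_ite, mul_one, mul_zero, ite_and]
    simp
  simpa using LinearMap.congr_fun h x

theorem entry_siteOp_zero_one (T : Module.End K (V ⊗[K] V)) (i j l m : ι) :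
    entry e (siteOp e T (0 : Fin 2) 1) ![i, j] ![l, m] = entry₂ e T i j l m := by
  rw [entry, repr_siteOp e T (by decide), ← tbasis_apply]
  simp only [Module.Basis.repr_self, Finsupp.single_apply, eq_comm (a := ![l, m]),
    update_update_eq_iff (show (0 : Fin 2) ≠ 1 by decide)]
  simp [ite_and, Fin.forall_fin_two]

/-- This brings identities proved for site operators, here with `k = 2`, back to `V ⊗ V`. -/
theorem siteOp_injective : Function.Injective fun T : Module.End K (V ⊗[K] V) =>
    siteOp e T (0 : Fin 2) 1 := by
  intro S T h
  refine (e.tensorProduct e).ext fun p =>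
    (e.tensorProduct e).repr.injective (Finsupp.ext fun p' => ?_)
  have := congrArg (fun X => entry e X ![p'.1, p'.2] ![p.1, p.2]) h
  simp only [entry_siteOp_zero_one] at this
  rw [Module.Basis.tensorProduct_apply]
  exact this

theorem entry_mul (S T : Module.End K (⨂[K] _ : Fin k, V)) (I J : Fin k → ι) :
    entry e (S * T) I J = ∑ L, entry e S I L * entry e T L J := by
  have h := (tbasis e k).sum_repr (T (tvec e J))
  simp only [entry, Module.End.mul_apply]
  conv_lhs => rw [← h]
  rw [map_sum, map_sum, Finsupp.coe_finsetSum, Finset.sum_apply]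
  simp [mul_comm, tbasis_apply]

theorem entry_siteOp_mul (T : Module.End K (V ⊗[K] V)) {a b : Fin k} (hab : a ≠ b)
    (S : Module.End K (⨂[K] _ : Fin k, V)) (I J : Fin k → ι) :
    entry e (siteOp e T a b * S) I J = ∑ l, ∑ m, entry₂ e T (I a) (I b) l m *
      entry e S (Function.update (Function.update I a l) b m) J :=
  repr_siteOp e T hab _ _

theorem entry_mul_siteOp (T : Module.End K (V ⊗[K] V)) {a b : Fin k} (hab : a ≠ b)
    (S : Module.End K (⨂[K] _ : Fin k, V)) (I J : Fin k → ι) :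
    entry e (S * siteOp e T a b) I J = ∑ i, ∑ j, entry₂ e T i j (J a) (J b) *
      entry e S I (Function.update (Function.update J a i) b j) := by
  simp [entry, siteOp_tvec e T hab]

end SiteOp

/-! ### Pairing operators -/

section Pairing

variable {K : Type*} [Field K] {V : Type*} [AddCommGroup V] [Module K V]
  {ι : Type*} [Fintype ι] [DecidableEq ι] (e : Module.Basis ι K V)
  (A : Module.End K (V ⊗[K] V)) {k : ℕ}

theorem prod_ofFn_update_update {M : Type*} [Monoid M] {ι : Type*} (x : ι → M) (J : Fin k → ι)
    {a b : Fin k} (hab : (b : ℕ) = a + 1) : ∃ p s : M, ∀ i j,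
      (List.ofFn fun t => x (Function.update (Function.update J a i) b j t)).prod =
        p * (x i * x j) * s := by
  refine ⟨(((List.ofFn J).take a).map x).prod, (((List.ofFn J).drop (a + 2)).map x).prod,
    fun i j => ?_⟩
  change (List.ofFn (x ∘ Function.update (Function.update J a i) b j)).prod = _
  rw [← List.map_ofFn, ofFn_update_update J hab]
  simp [mul_assoc]

theorem psiStar_mul_psiStar (i j : ι) : psiStar e A i * psiStar e A j =
    ∑ l, ∑ m, entry₂ e A i j l m • (psiStar e A l * psiStar e A m) := by
  have h := RingQuot.mkAlgHom_rel K (XiStarRel.rel (e := e) (A := A) i j)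
  rw [map_zero] at h
  rw [← sub_eq_zero, ← h]
  simp [entry₂_one_sub, sub_smul, psiStar, ite_smul]

theorem sum_entry₂_smul_psiMon {a b : Fin k} (hab : (b : ℕ) = a + 1) (J : Fin k → ι) :
    ∑ i, ∑ j, entry₂ e A i j (J a) (J b) •
      psiMon e A (Function.update (Function.update J a i) b j) = psiMon e A J := by
  obtain ⟨p, s, h⟩ := prod_ofFn_update_update (psi e A) J hab
  have hJ := h (J a) (J b)
  rw [Function.update_eq_self, Function.update_eq_self] at hJ
  rw [psiMon, hJ, psi_mul_psi]
  simp only [psiMon, h, Finset.mul_sum, Finset.sum_mul, mul_smul_comm, smul_mul_assoc]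

theorem sum_entry₂_smul_psiStarMon {a b : Fin k} (hab : (b : ℕ) = a + 1) (I : Fin k → ι) :
    ∑ l, ∑ m, entry₂ e A (I a) (I b) l m •
      psiStarMon e A (Function.update (Function.update I a l) b m) = psiStarMon e A I := by
  obtain ⟨p, s, h⟩ := prod_ofFn_update_update (psiStar e A) I hab
  have hJ := h (I a) (I b)
  rw [Function.update_eq_self, Function.update_eq_self] at hJ
  rw [psiStarMon, hJ, psiStar_mul_psiStar]
  simp only [psiStarMon, h, Finset.mul_sum, Finset.sum_mul, mul_smul_comm, smul_mul_assoc]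

/-- The product `(Ψ ⊗ ⋯ ⊗ Ψ) T`, as a linear function of `T`. -/
noncomputable def psiMul : Module.End K (⨂[K] _ : Fin k, V) →ₗ[K] (Fin k → ι) → Xi e A where
  toFun T J := ∑ I, entry e T I J • psiMon e A I
  map_add' S T := by
    funext J
    simp [entry, add_smul, Finset.sum_add_distrib]
  map_smul' c T := by
    funext J
    simp [entry, mul_smul, Finset.smul_sum]

/-- The product `T (Ψ* ⊗ ⋯ ⊗ Ψ*)`, as a linear function of `T`. -/
noncomputable def mulPsiStar : Module.End K (⨂[K] _ : Fin k, V) →ₗ[K] (Fin k → ι) → XiStar e A where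
  toFun T I := ∑ J, entry e T I J • psiStarMon e A J
  map_add' S T := by
    funext J
    simp [entry, add_smul, Finset.sum_add_distrib]
  map_smul' c T := by
    funext J
    simp [entry, mul_smul, Finset.smul_sum]

theorem entry_one (I J : Fin k → ι) :
    entry e (1 : Module.End K (⨂[K] _ : Fin k, V)) I J = if I = J then 1 else 0 := by
  simp [entry, ← tbasis_apply, Finsupp.single_apply, eq_comm]

theorem psiMul_one (J : Fin k → ι) : psiMul e A 1 J = psiMon e A J := by
  simp [psiMul, entry_one]

theorem mulPsiStar_one (I : Fin k → ι) : mulPsiStar e A 1 I = psiStarMon e A I := by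
  simp [mulPsiStar, entry_one]

theorem psiMul_mul (S T : Module.End K (⨂[K] _ : Fin k, V)) (J : Fin k → ι) :
    psiMul e A (S * T) J = ∑ L, entry e T L J • psiMul e A S L := by
  simp only [psiMul, LinearMap.coe_mk, AddHom.coe_mk, entry_mul, Finset.sum_smul, Finset.smul_sum,
    smul_smul]
  rw [Finset.sum_comm]
  simp only [mul_comm]

theorem mulPsiStar_mul (S T : Module.End K (⨂[K] _ : Fin k, V)) (I : Fin k → ι) :
    mulPsiStar e A (S * T) I = ∑ L, entry e S I L • mulPsiStar e A T L := by
  simp only [mulPsiStar, LinearMap.coe_mk, AddHom.coe_mk, entry_mul, Finset.sum_smul,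
    Finset.smul_sum, smul_smul]
  rw [Finset.sum_comm]

theorem psiMul_siteOp {a b : Fin k} (hab : (b : ℕ) = a + 1) :
    psiMul e A (siteOp e A a b) = psiMul e A 1 := by
  funext J
  have hne : a ≠ b := fun h => by rw [h] at hab; omega
  rw [psiMul_one, ← sum_entry₂_smul_psiMon e A hab, ← one_mul (siteOp e A a b)]
  simp only [psiMul, LinearMap.coe_mk, AddHom.coe_mk, entry_mul_siteOp e A hne, entry_one,
    Finset.sum_smul, mul_ite, mul_one, mul_zero, ite_smul, zero_smul]
  rw [Finset.sum_comm]
  refine Finset.sum_congr rfl fun i _ => ?_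
  rw [Finset.sum_comm]
  simp

theorem mulPsiStar_siteOp {a b : Fin k} (hab : (b : ℕ) = a + 1) :
    mulPsiStar e A (siteOp e A a b) = mulPsiStar e A 1 := by
  funext J
  have hne : a ≠ b := fun h => by rw [h] at hab; omega
  rw [mulPsiStar_one, ← sum_entry₂_smul_psiStarMon e A hab, ← mul_one (siteOp e A a b)]
  simp only [mulPsiStar, LinearMap.coe_mk, AddHom.coe_mk, entry_siteOp_mul e A hne]
  simp only [entry_one, Finset.sum_smul, mul_ite, mul_one, mul_zero, ite_smul, zero_smul]
  rw [Finset.sum_comm]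
  refine Finset.sum_congr rfl fun i _ => ?_
  rw [Finset.sum_comm]
  simp

theorem psiMul_siteOp_mul {a b : Fin k} (hab : (b : ℕ) = a + 1)
    (T : Module.End K (⨂[K] _ : Fin k, V)) :
    psiMul e A (siteOp e A a b * T) = psiMul e A T := by
  funext J
  rw [psiMul_mul, psiMul_siteOp e A hab, ← psiMul_mul, one_mul]

theorem mulPsiStar_mul_siteOp {a b : Fin k} (hab : (b : ℕ) = a + 1)
    (T : Module.End K (⨂[K] _ : Fin k, V)) :
    mulPsiStar e A (T * siteOp e A a b) = mulPsiStar e A T := by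
  funext J
  rw [mulPsiStar_mul, mulPsiStar_siteOp e A hab, ← mulPsiStar_mul, mul_one]

variable {e A} in
theorem XiDeg.linearMap_ext {P : Type*} [AddCommMonoid P] [Module K P]
    {f g : XiDeg e A k →ₗ[K] P} (h : ∀ J, f (psiDeg e A J) = g (psiDeg e A J)) : f = g := by
  refine LinearMap.ext_on (Submodule.span_span_coe_preimage (R := K)
    (s := Set.range fun J : Fin k → ι => psiMon e A J)) ?_
  rintro ⟨_, _⟩ ⟨J, rfl⟩
  exact h J

variable {e A} in
theorem XiStarDeg.linearMap_ext {P : Type*} [AddCommMonoid P] [Module K P]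
    {f g : XiStarDeg e A k →ₗ[K] P} (h : ∀ I, f (psiStarDeg e A I) = g (psiStarDeg e A I)) :
    f = g := by
  refine LinearMap.ext_on (Submodule.span_span_coe_preimage (R := K)
    (s := Set.range fun I : Fin k → ι => psiStarMon e A I)) ?_
  rintro ⟨_, _⟩ ⟨I, rfl⟩
  exact h I

/-- The entries of `T` satisfy the relations of `Ξ_A` in the lower index by `right_mul` and those of
`Ξ*_A` in the upper index by `left_mul`, so they descend in each variable. -/
theorem IsPairingAOp.exists_pairing {T : Module.End K (⨂[K] _ : Fin k, V)}
    (hT : IsPairingAOp e A k T) : ∃ B : XiStarDeg e A k →ₗ[K] XiDeg e A k →ₗ[K] K,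
      (∀ I J, B (psiStarDeg e A I) (psiDeg e A J) = entry e T I J) ∧ B.Nondegenerate := by
  have hne : ∀ {a b : Fin k}, (b : ℕ) = a + 1 → a ≠ b := fun hab h => by rw [h] at hab; omega
  have zero : ∀ I J, entry e (0 : Module.End K (⨂[K] _ : Fin k, V)) I J = 0 := fun I J => by
    simp [entry]
  obtain ⟨f, hf⟩ := exists_linearMap_quadratic (k := k) (r := XiRel e A) (entry₂ e (1 - A))
    (fun _ _ ⟨l, m⟩ => ⟨l, m, rfl, rfl⟩) (fun J I => entry e T I J) (by
      intro a b hab J l m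
      funext I
      have h := congrArg (fun X => entry e X I (Function.update (Function.update J a l) b m))
        (hT.right_mul a b hab)
      rw [← siteOp_one e (hne hab), ← siteOp_sub] at h
      simp only [entry_mul_siteOp e _ (hne hab), Function.update_self,
        Function.update_of_ne (hne hab), update_update_idem (hne hab), zero] at h
      simpa using h)
  obtain ⟨g, hg⟩ := exists_linearMap_quadratic (k := k) (r := XiStarRel e A)
    (fun l m i j => entry₂ e (1 - A) i j l m) (fun _ _ ⟨i, j⟩ => ⟨i, j, rfl, rfl⟩)
    (fun I => LinearMap.proj I ∘ₗ f ∘ₗ (XiDeg e A k).subtype) (by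
      intro a b hab I i j
      refine XiDeg.linearMap_ext fun J => ?_
      have h := congrArg (fun X => entry e X (Function.update (Function.update I a i) b j) J)
        (hT.left_mul a b hab)
      rw [← siteOp_one e (hne hab), ← siteOp_sub] at h
      simp only [entry_siteOp_mul e _ (hne hab), Function.update_self,
        Function.update_of_ne (hne hab), update_update_idem (hne hab), zero] at h
      have h2 : f (psiMon e A J) = _ := hf J
      simpa [psiDeg, h2] using h)
  have hB : ∀ I J, (g ∘ₗ (XiStarDeg e A k).subtype) (psiStarDeg e A I) (psiDeg e A J) =
      entry e T I J := by
    intro I J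
    have h1 : g (psiStarMon e A I) = _ := hg I
    have h2 : f (psiMon e A J) = _ := hf J
    simp [psiStarDeg, psiDeg, h1, h2]
  set B := g ∘ₗ (XiStarDeg e A k).subtype
  refine ⟨B, hB, fun x h => ?_, fun y h => ?_⟩
  -- The identity `T (Ψ* ⊗ ⋯ ⊗ Ψ*) = Ψ* ⊗ ⋯ ⊗ Ψ*` reads `x = ∑ J, B x ψ_J • ψ^J`, so an `x`
  -- orthogonal to all monomials is zero.
  · have key : ∑ J, (B.flip (psiDeg e A J)).smulRight (psiStarDeg e A J) = LinearMap.id := by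
      refine XiStarDeg.linearMap_ext fun I => Subtype.ext ?_
      simp only [LinearMap.sum_apply, LinearMap.smulRight_apply, LinearMap.flip_apply, hB]
      simpa [psiStarDeg] using hT.mul_psiStar I
    have := LinearMap.congr_fun key x
    simpa [h, eq_comm] using this
  · have key : ∑ I, (B (psiStarDeg e A I)).smulRight (psiDeg e A I) = LinearMap.id := by
      refine XiDeg.linearMap_ext fun J => Subtype.ext ?_
      simp only [LinearMap.sum_apply, LinearMap.smulRight_apply, hB]
      simpa [psiDeg] using hT.psi_mul J
    have := LinearMap.congr_fun key y
    simpa [h, eq_comm] using this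

end Pairing

/-! ### Minors of Manin matrices -/

section Minors

variable {K : Type*} [Field K] {V : Type*} [AddCommGroup V] [Module K V]
  {ι : Type*} [Fintype ι] [DecidableEq ι] (e : Module.Basis ι K V)
  (A : Module.End K (V ⊗[K] V))
  {W : Type*} [AddCommGroup W] [Module K W] {κ : Type*} [Fintype κ] [DecidableEq κ]
  (e' : Module.Basis κ K W) (A' : Module.End K (W ⊗[K] W))
  {R : Type*} [Ring R] [Algebra K R]

theorem prod_ofFn_sum {S : Type*} [Ring S] {ι : Type*} [Fintype ι] {k : ℕ} (y : Fin k → ι → S) :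
    (List.ofFn fun t => ∑ i, y t i).prod = ∑ J : Fin k → ι, (List.ofFn fun t => y t (J t)).prod := by
  induction k with
  | zero => simp
  | succ k ih =>
    simp only [List.ofFn_succ, List.prod_cons, ih, Finset.sum_mul_sum]
    rw [← (Fin.consEquiv fun _ => ι).sum_comp, Fintype.sum_prod_type]
    rfl

theorem prod_ofFn_tmul {k : ℕ} {S : Type*} [Ring S] [Algebra K S] (x : Fin k → R) (y : Fin k → S) :
    (List.ofFn fun t => x t ⊗ₜ[K] y t).prod = (List.ofFn x).prod ⊗ₜ[K] (List.ofFn y).prod := by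
  induction k with
  | zero => simp [Algebra.TensorProduct.one_def]
  | succ k ih => simp [List.ofFn_succ, ih]

theorem maninHom_psiMon (M : Matrix ι κ R) (hM : IsManin e A e' A' M) {k : ℕ} (α : Fin k → κ) :
    maninHom e A e' A' M hM (psiMon e' A' α) =
      ∑ J : Fin k → ι, (List.ofFn fun t => M (J t) (α t)).prod ⊗ₜ[K] psiMon e A J := by
  have h : ∀ i, maninHom e A e' A' M hM (psi e' A' i) = ∑ j, M j i ⊗ₜ[K] psi e A j := fun i => by
    simp [maninHom, psi]
  rw [psiMon, map_list_prod, List.map_ofFn]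
  simp only [Function.comp_def, h, prod_ofFn_sum, prod_ofFn_tmul]
  rfl

theorem minorsArePairing {k : ℕ} (T : Module.End K (⨂[K] _ : Fin k, V))
    (B : XiStarDeg e A k →ₗ[K] XiDeg e A k →ₗ[K] K)
    (hB : ∀ I J, B (psiStarDeg e A I) (psiDeg e A J) = entry e T I J)
    (M : Matrix ι κ R) (hM : IsManin e A e' A' M) : MinorsArePairing e A e' A' T B M hM := by
  -- A linear retraction onto the graded component, tensored with `R`, lets the degree `k` part of
  -- `f^M` take values in `R ⊗ (Ξ_A)_k`.
  obtain ⟨p, hp⟩ : ∃ p : Xi e A →ₗ[K] XiDeg e A k, p ∘ₗ (XiDeg e A k).subtype = LinearMap.id :=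
    LinearMap.exists_leftInverse_of_injective (K := K) (V := XiDeg e A k) (V' := Xi e A) _
      (LinearMap.ker_eq_bot_of_injective (XiDeg e A k).injective_subtype)
  have hp' : ∀ J : Fin k → ι, p (psiMon e A J) = psiDeg e A J := fun J =>
    LinearMap.congr_fun hp (psiDeg e A J)
  refine ⟨LinearMap.lTensor R p ∘ₗ (maninHom e A e' A' M hM).toLinearMap ∘ₗ
    (XiDeg e' A' k).subtype, ?_, ?_⟩
  · rintro ⟨x, hx⟩
    simp only [LinearMap.comp_apply, Submodule.subtype_apply, AlgHom.toLinearMap_apply]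
    induction hx using Submodule.span_induction with
    | mem x hx =>
      obtain ⟨α, rfl⟩ := hx
      simp [maninHom_psiMon, hp', psiDeg]
    | zero => simp
    | add x y _ _ hx hy => simp only [map_add, hx, hy]
    | smul c x _ hx => simp only [map_smul, hx]
  · intro I α
    simp [minorA, pairR, psiDeg, maninHom_psiMon, hp', ← hB]

end Minors

/-! ### The symplectic pairing operator -/

section Symplectic

variable {K : Type*} [Field K] {r : ℕ} {V : Type*} [AddCommGroup V] [Module K V]
  (e : Module.Basis (SympIndex r) K V) {q : SympIndex r → SympIndex r → K} {v : SympIndex r → K}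
  {k : ℕ}

theorem siteOp_opC {a b : Fin k} (hab : a ≠ b) : siteOp e (opC e q v) a b =
    (2 : K)⁻¹ • (1 - siteOp e (permOp e q) a b) - (2 * (r : K))⁻¹ • siteOp e (opQ e v) a b := by
  rw [opC, siteOp_sub, siteOp_smul, siteOp_smul, siteOp_sub, siteOp_one e hab]

/-- From `P² = 1`, `Q² = 2r Q` and `PQ = QP = -Q`: `(1 - P)/2` and `Q/(2r)` are idempotents, and the
first fixes the second on both sides. -/
theorem isIdempotentElem_opC [CharZero K] (h : IsTypeCFamily q v) (hr : r ≠ 0) :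
    IsIdempotentElem (opC e q v) := by
  refine siteOp_injective e ?_
  have hab : (0 : Fin 2) ≠ 1 := by decide
  have hr' : (r : K) ≠ 0 := Nat.cast_ne_zero.2 hr
  simp only [siteOp_mul e _ _ hab, siteOp_opC e hab]
  have h1 := permOp_sq e h hab
  have h2 := opQ_sq e h hab
  have h3 := permOp_opQ e h hab
  have h4 := opQ_permOp e h hab
  simp only [sub_mul, mul_sub, smul_mul_assoc, mul_smul_comm, one_mul, mul_one, h1, h2, h3, h4]
  match_scalars <;> field_simp <;> ring

theorem isPairingAOp_opCk [CharZero K] (h : IsTypeCFamily q v) (hk : 2 ≤ k) (hkr : k ≤ r + 1) :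
    IsPairingAOp e (opC e q v) k (opCk e k h) := by
  have H := isBrauerSystem_sig_eps K k (-2 * (r : K))
  -- The bound `k ≤ r + 1` enters here: `m ≤ k - 2 ≤ r - 1`, so no denominator `2(m - r)` vanishes.
  have hω : ∀ m < k - 1, 2 * (m : K) + -2 * (r : K) ≠ 0 := fun m hm h0 => by
    have h1 : (m : K) = r := by linear_combination h0 / 2
    have h2 : m = r := by exact_mod_cast h1
    omega
  have hS := symmetrizer_eq_symm (K := K) (k := k) (ω := -2 * (r : K)) (by omega)
  -- Sites are counted from `0` and generators from `1`, so generator `a + 1` acts in the sites `a`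
  -- and `a + 1`.
  have hsite : ∀ a (ha : a + 1 < k),
      siteOp e (permOp e q) ⟨a, by omega⟩ ⟨a + 1, ha⟩ = -rho e k h (sig K k _ (a + 1)) ∧
      siteOp e (opQ e v) ⟨a, by omega⟩ ⟨a + 1, ha⟩ = -rho e k h (eps K k _ (a + 1)) := by
    intro a ha
    rw [sig_of_lt ⟨by omega, ha⟩, eps_of_lt ⟨by omega, ha⟩, rho, RingQuot.liftAlgHom_mkAlgHom_apply,
      RingQuot.liftAlgHom_mkAlgHom_apply]
    simp [freeSigma, freeEps, rhoGen]
  have hC : ∀ a (ha : a + 1 < k), siteOp e (opC e q v) ⟨a, by omega⟩ ⟨a + 1, ha⟩ =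
      rho e k h ((2 : K)⁻¹ • (1 + sig K k _ (a + 1)) - (-2 * (r : K))⁻¹ • eps K k _ (a + 1)) := by
    intro a ha
    rw [siteOp_opC e (by simp [Fin.ext_iff]), (hsite a ha).1, (hsite a ha).2, map_sub, map_smul,
      map_smul, map_add, map_one, show (-2 * (r : K))⁻¹ = -(2 * (r : K))⁻¹ by rw [neg_mul, inv_neg],
      sub_neg_eq_add, smul_neg]
    module
  have two : ∀ x : Brauer K k (-2 * (r : K)), (2 : K)⁻¹ • (x + x) = x := fun x => by
    rw [← two_smul K, smul_smul, inv_mul_cancel₀ two_ne_zero, one_smul]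
  have ext : ∀ (P : ∀ a b : Fin k, Prop), (∀ a (ha : a + 1 < k), P ⟨a, by omega⟩ ⟨a + 1, ha⟩) →
      ∀ a b : Fin k, (b : ℕ) = a + 1 → P a b := by
    rintro P hP ⟨a, ha⟩ ⟨b, hb⟩ rfl
    exact hP a hb
  refine ⟨ext _ fun a ha => ?_, ext _ fun a ha => ?_, ?_, ?_⟩
  · obtain ⟨h1, h2⟩ := H.left_symm le_rfl (show a < k - 1 by omega)
    rw [hC a ha, opCk, hS, sub_mul, one_mul, ← map_mul, sub_mul, smul_mul_assoc, smul_mul_assoc,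
      h2, add_mul, one_mul, h1, two, smul_zero, sub_zero, sub_self]
  · obtain ⟨h1, h2⟩ := H.right_symm le_rfl (show a < k - 1 by omega)
    rw [hC a ha, opCk, hS, mul_sub, mul_one, ← map_mul, mul_sub, mul_smul_comm, mul_smul_comm,
      h2, mul_add, mul_one, h1, two, smul_zero, sub_zero, sub_self]
  · intro J
    -- The map `T ↦ (Ψ ⊗ ⋯ ⊗ Ψ) T` ignores a left factor `C_q^{(a,a+1)}` by the relations of `Ξ`, so
    -- it takes the same value on `ρ(s_(k))` as on `1`.
    have key := H.map_symm_of_left hω (psiMul e (opC e q v) ∘ₗ (rho e k h).toLinearMap)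
      fun a ha x => by
        rw [LinearMap.comp_apply, AlgHom.toLinearMap_apply, map_mul, ← hC a (by omega),
          psiMul_siteOp_mul e _ rfl]
        rfl
    rw [← psiMul_one, ← map_one (rho e k h)]
    rw [← hS] at key
    exact congrFun key J
  · intro I
    have key := H.map_symm_of_right hω (mulPsiStar e (opC e q v) ∘ₗ (rho e k h).toLinearMap)
      fun a ha x => by
        rw [LinearMap.comp_apply, AlgHom.toLinearMap_apply, map_mul, ← hC a (by omega),
          mulPsiStar_mul_siteOp e _ rfl]
        rfl
    rw [← mulPsiStar_one, ← map_one (rho e k h)]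
    rw [← hS] at key
    exact congrFun key I

end Symplectic

end ManinC

theorem mainTheorem2 {K : Type*} [Field K] [CharZero K] {V : Type*} [AddCommGroup V] [Module K V]
    {r : ℕ} (e : Module.Basis (ManinC.SympIndex r) K V)
    (q : ManinC.SympIndex r → ManinC.SympIndex r → K) (v : ManinC.SympIndex r → K)
    (h : ManinC.IsTypeCFamily q v) (k : ℕ) (hk : 2 ≤ k) (hkr : k ≤ r + 1) :
    IsIdempotentElem (ManinC.opC e q v) ∧
    ManinC.IsPairingAOp e (ManinC.opC e q v) k (ManinC.opCk e k h) ∧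
    ∃ B : ManinC.XiStarDeg e (ManinC.opC e q v) k →ₗ[K]
        ManinC.XiDeg e (ManinC.opC e q v) k →ₗ[K] K,
      (∀ I J : Fin k → ManinC.SympIndex r,
        B (ManinC.psiStarDeg e (ManinC.opC e q v) I) (ManinC.psiDeg e (ManinC.opC e q v) J) =
          ManinC.entry e (ManinC.opCk e k h) I J) ∧
      B.Nondegenerate ∧
      (∀ {W : Type*} [AddCommGroup W] [Module K W] {κ : Type*} [Fintype κ] [DecidableEq κ]
        (e' : Module.Basis κ K W) (A' : Module.End K (W ⊗[K] W)) (_ : IsIdempotentElem A')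
        {R : Type*} [Ring R] [Algebra K R] (M : Matrix (ManinC.SympIndex r) κ R)
        (hM : ManinC.IsManin e (ManinC.opC e q v) e' A' M),
        ManinC.MinorsArePairing e (ManinC.opC e q v) e' A' (ManinC.opCk e k h) B M hM) ∧
      (∀ {W : Type*} [AddCommGroup W] [Module K W] {κ : Type*} [Fintype κ] [DecidableEq κ]
        (e' : Module.Basis κ K W) (p : κ → κ → K) (_ : ManinC.IsParameterMatrix p)
        {R : Type*} [Ring R] [Algebra K R] (M : Matrix (ManinC.SympIndex r) κ R)
        (hM : ManinC.IsManin e (ManinC.opC e q v) e' (ManinC.idemA e' p) M),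
        ManinC.MinorsArePairing e (ManinC.opC e q v) e' (ManinC.idemA e' p)
          (ManinC.opCk e k h) B M hM) := by
  have hT := ManinC.isPairingAOp_opCk e h hk hkr
  obtain ⟨B, hB, hnd⟩ := hT.exists_pairing
  exact ⟨ManinC.isIdempotentElem_opC e h (by omega), hT, B, hB, hnd,
    fun e' A' _ _ _ _ M hM => ManinC.minorsArePairing e _ e' A' _ B hB M hM,
    fun e' p _ _ _ _ M hM => ManinC.minorsArePairing e _ e' _ _ B hB M hM⟩
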